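/- Let $(V_*,\mathbf g)$ be a (nonempty, Hausdorff) smooth $4$-dimensional Lorentzian manifold of signature $(-,+,+,+)$ and let $u,\underline u\in C^\infty(V_*)$ define a double null cone foliation: both solve the eikonal equation $g^{\mu\nu}\partial_\mu w\,\partial_\nu w=0$ and, with $L^\mu=-g^{\mu\nu}\partial_\nu u$, $\underline L^\mu=-g^{\mu\nu}\partial_\nu\underline u$, one has $\mathbf g(L,\underline L)<0$. Define the lapse $\Omega>0$ by $\mathbf g(L,\underline L)=-(2\Omega^2)^{-1}$ and put $N=2\Omega^2L$, $\underline N=2\Omega^2\underline L$; the integral curves of $\underline N$ are the incoming generators (on them $\underline u$ is constant, and $u$ is a parameter). Let $\Sigma\subset V_*$ be a piece of the initial hypersurface: a smooth spacelike hypersurface which no incoming generator meets twice, smoothly and injectively parametrized by coordinates $(\underline u,\omega_0^1,\omega_0^2)$ ranging over an open subset of $\mathbb R^3$, where $\omega_0^1,\omega^2_0$ are arbitrary angular coordinates. *Kerr shift.* Let $M>0$, $|a|\le M$ and, in Boyer–Lindquist coordinates, $\Delta=r^2+a^2-2Mr$, $\Sigma_K=r^2+a^2\cos^2\theta$, $\Sigma_K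 R^2=(r^2+a^2)^2-\Delta a^2\sin^2\theta$, $\omega_B=2Mar/(\Sigma_K R^2)$. Let $(r_*,\theta_*)$ be Pretorius–Israel coordinates of the Kerr exterior over the external region $r_*>s_0$: a smooth change of coordinates $(r,\theta)\mapsto(r_*,\theta_*)$, from an open subset of $\{r>M+\sqrt{M^2-a^2},\ 0<\theta<\pi\}$ onto $(s_0,\infty)\times(0,\pi)$, with $$dr_*=\tfrac{Q}{\Delta}\,dr+P\,d\theta,\qquad Q\,\partial_r\theta_*+P\,\partial_\theta\theta_*=0,$$ $$Q^2=(r^2+a^2)^2-a^2\lambda\Delta,\quad P^2=a^2(\lambda-\sin^2\theta),\quad \lambda=\sin^2\theta_*\ge\sin^2\theta,$$ where $Q\ge0$, $\theta$ and $\theta_*$ lie in the same (closed) hemisphere, and $P\geq 0$ in the northern, $P\le0$ in the southern hemisphere. Expressing $\omega_B$ through $(r_*,\theta_*)$ and setting $r_*=\underline u-u$, $\theta_*=\omega^1$ gives a function $\omega_B(u,\underline u,\omega^1)$. Put $X_{Kerr}=\omega_B\,\partial/\partial\omega^2$ (with $\omega^2=\phi$). **Claim.** Let $U\subset V_*$ be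 the set of the points $p$ with $\underline u(p)-u(p)>s_0$ that lie on the incoming generator through some point $p_0\in\Sigma$ with $\omega_0^1(p_0)\in(0,\pi)$. There is a smooth function $f(u,\underline u,\omega^1)$ on $\{\underline u-u>s_0,\ 0<\omega^1<\pi\}$ with $\partial f/\partial u=\omega_B(u,\underline u,\omega^1)$, such that $U$ is open and $$\big(u,\ \underline u,\ \omega^1,\ \omega^2\big),\qquad \omega^1(p)=\omega_0^1(p_0),\quad \omega^2(p)=\omega_0^2(p_0)+f\big(u(p),\underline u(p),\omega_0^1(p_0)\big),$$ is a smooth coordinate system on all of $U$. In these coordinates $$\underline N=\frac{\partial}{\partial u}+X_{Kerr},\qquad N=\frac{\partial}{\partial\underline u}+X,\quad X=X^a\frac{\partial}{\partial\omega^a},$$ and the metric has the form $$\mathbf g=-4\Omega^2\,du\,d\underline u+\gamma_{ab}\big(d\omega^a-(X_{Kerr}^a\,du+X^a\,d\underline u)\big)\big(d\omega^b-(X_{Kerr}^b\,du+X^b\,d\underline u)\big),$$ where $X^a$ and $\gamma_{ab}$ are smooth functions on $U$, $(\gamma_{ab})$ is symmetric and positive definite, and $du\,d\underline u$ is the symmetric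 product $\tfrac12(du\otimes d\underline u+d\underline u\otimes du)$. -/

import Mathlib

open Set Manifold ContDiff

noncomputable section

namespace KerrFoliation

/-! ### The Kerr shift in Pretorius–Israel coordinates -/

/-- `Δ = r² + a² - 2 M r`. -/
def kerrDelta (M a r : ℝ) : ℝ := r ^ 2 + a ^ 2 - 2 * M * r

/-- `Σ = r² + a² cos² θ`. -/
def kerrSigma (a r θ : ℝ) : ℝ := r ^ 2 + a ^ 2 * Real.cos θ ^ 2

/-- `R² = ((r² + a²)² - Δ a² sin² θ) / Σ`. -/
def kerrRsq (M a r θ : ℝ) : ℝ :=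
  ((r ^ 2 + a ^ 2) ^ 2 - kerrDelta M a r * a ^ 2 * Real.sin θ ^ 2) / kerrSigma a r θ

/-- `ω_B = 2 M a r / (Σ R²)` as a function of the Boyer–Lindquist coordinates `r, θ`. -/
def kerrOmegaBL (M a r θ : ℝ) : ℝ := 2 * M * a * r / (kerrSigma a r θ * kerrRsq M a r θ)

/-- `Q ≥ 0` with `Q² = (r² + a²)² - a² λ Δ`, where `λ = sin² θ_*`. -/
def israelQ (M a r θs : ℝ) : ℝ :=
  Real.sqrt ((r ^ 2 + a ^ 2) ^ 2 - a ^ 2 * Real.sin θs ^ 2 * kerrDelta M a r)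

/-- `P² = a² (λ - sin² θ)`, where `λ = sin² θ_*`; the root `P` is nonnegative in the northern
hemisphere and nonpositive in the southern one. -/
def israelP (a θ θs : ℝ) : ℝ :=
  if 0 ≤ Real.cos θs then |a| * Real.sqrt (Real.sin θs ^ 2 - Real.sin θ ^ 2)
  else -(|a| * Real.sqrt (Real.sin θs ^ 2 - Real.sin θ ^ 2))

/-- Pretorius–Israel coordinates `(r_*, θ_*)` in the external region `r_* > s₀` of the Kerr
exterior, given as a smooth change of coordinates `(r, θ) ↦ (r_*, θ_*)` from the
Boyer–Lindquist `(r, θ)`. The function `r_*` is a solution of the eikonal equation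
`Δ (∂_r r_*)² + (∂_θ r_*)² = Σ R² / Δ`, namely `dr_* = (Q / Δ) dr + P dθ`, and `θ_*` is
orthogonal to it, `Q ∂_r θ_* + P ∂_θ θ_* = 0`. -/
structure PretoriusIsraelChart (M a s₀ : ℝ) where
  chart : OpenPartialHomeomorph (ℝ × ℝ) (ℝ × ℝ)
  contDiffOn_chart : ContDiffOn ℝ ∞ chart chart.source
  contDiffOn_symm : ContDiffOn ℝ ∞ chart.symm chart.target
  source_subset : chart.source ⊆ Ioi (M + Real.sqrt (M ^ 2 - a ^ 2)) ×ˢ Ioo 0 Real.pi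
  target_eq : chart.target = Ioi s₀ ×ˢ Ioo 0 Real.pi
  sin_sq_le : ∀ x ∈ chart.source, Real.sin x.2 ^ 2 ≤ Real.sin (chart x).2 ^ 2
  same_hemisphere : ∀ x ∈ chart.source, 0 ≤ Real.cos x.2 * Real.cos (chart x).2
  fderiv_rstar : ∀ x ∈ chart.source, ∀ v : ℝ × ℝ,
    fderiv ℝ (fun y => (chart y).1) x v =
      israelQ M a x.1 (chart x).2 / kerrDelta M a x.1 * v.1 + israelP a x.2 (chart x).2 * v.2
  fderiv_thetastar : ∀ x ∈ chart.source,
    fderiv ℝ (fun y => (chart y).2) x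
      (israelQ M a x.1 (chart x).2, israelP a x.2 (chart x).2) = 0

/-- `ω_B(u, u̲, ω¹)`: the Kerr function `ω_B` at `r_* = u̲ - u`, `θ_* = ω¹`. -/
def PretoriusIsraelChart.omegaB {M a s₀ : ℝ} (Φ : PretoriusIsraelChart M a s₀)
    (u ub ω₁ : ℝ) : ℝ :=
  kerrOmegaBL M a (Φ.chart.symm (ub - u, ω₁)).1 (Φ.chart.symm (ub - u, ω₁)).2

/-- The components of `X_Kerr = ω_B ∂/∂ω²`; the index `a = 0, 1` stands for `ω¹, ω²`. -/
def PretoriusIsraelChart.shift {M a s₀ : ℝ} (Φ : PretoriusIsraelChart M a s₀)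
    (u ub ω₁ : ℝ) : Fin 2 → ℝ :=
  ![0, Φ.omegaB u ub ω₁]

/-! ### Lorentzian metrics -/

/-- The diagonal entries of the Minkowski matrix `diag(-1, 1, 1, 1)`. -/
def minkowskiSign (i : Fin 4) : ℝ := if i = 0 then -1 else 1

/-- A smooth Lorentzian metric, of signature `(-, +, +, +)`, on a smooth 4-manifold. -/
structure LorentzMetric (V : Type*) [TopologicalSpace V]
    [ChartedSpace (EuclideanSpace ℝ (Fin 4)) V] [IsManifold (𝓡 4) ∞ V] where
  val (p : V) : TangentSpace (𝓡 4) p →L[ℝ] TangentSpace (𝓡 4) p →L[ℝ] ℝ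
  symm (p : V) (v w : TangentSpace (𝓡 4) p) : val p v w = val p w v
  exists_frame (p : V) : ∃ b : Module.Basis (Fin 4) ℝ (TangentSpace (𝓡 4) p),
    ∀ i j, val p (b i) (b j) = if i = j then minkowskiSign i else 0
  contMDiff : ContMDiff (𝓡 4)
    ((𝓡 4).prod 𝓘(ℝ, EuclideanSpace ℝ (Fin 4) →L[ℝ] EuclideanSpace ℝ (Fin 4) →L[ℝ] ℝ)) ∞
    (fun p ↦ Bundle.TotalSpace.mk'
      (EuclideanSpace ℝ (Fin 4) →L[ℝ] EuclideanSpace ℝ (Fin 4) →L[ℝ] ℝ)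
      (E := fun p : V => TangentSpace (𝓡 4) p →L[ℝ] TangentSpace (𝓡 4) p →L[ℝ] ℝ)
      p (val p))

/-- The differential of a real function, as a linear form on the tangent space. -/
def diff {V : Type*} [TopologicalSpace V] [ChartedSpace (EuclideanSpace ℝ (Fin 4)) V]
    (f : V → ℝ) (p : V) : TangentSpace (𝓡 4) p →L[ℝ] ℝ :=
  mfderiv (𝓡 4) 𝓘(ℝ) f p

namespace LorentzMetric

variable {V : Type*} [TopologicalSpace V] [ChartedSpace (EuclideanSpace ℝ (Fin 4)) V]
  [IsManifold (𝓡 4) ∞ V] (g : LorentzMetric V)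

theorem eq_zero_of_forall (p : V) (v : TangentSpace (𝓡 4) p) (hv : ∀ w, g.val p v w = 0) :
    v = 0 := by
  obtain ⟨b, hb⟩ := g.exists_frame p
  refine b.ext_elem_iff.2 fun i => ?_
  have h := hv (b i)
  rw [← b.sum_repr v] at h
  simp only [map_sum, map_smul, sum_apply, smul_apply,
    hb, smul_eq_mul, mul_ite, mul_zero, Finset.sum_ite_eq', Finset.mem_univ, if_true] at h
  have hs : minkowskiSign i ≠ 0 := by
    unfold minkowskiSign
    split_ifs <;> norm_num
  simpa [hs] using h

/-- The metric as a linear map from vectors to covectors. -/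
def flat (p : V) :
    TangentSpace (𝓡 4) p →ₗ[ℝ] Module.Dual ℝ (TangentSpace (𝓡 4) p) :=
  LinearMap.mk₂ ℝ (fun v w => g.val p v w) (by simp) (by simp) (by simp) (by simp)

theorem flat_injective (p : V) : Function.Injective (g.flat p) := by
  rw [← LinearMap.ker_eq_bot, LinearMap.ker_eq_bot']
  intro v hv
  exact g.eq_zero_of_forall p v fun w => by
    simpa [flat] using congrArg (fun l => l w) hv

instance (p : V) : FiniteDimensional ℝ (TangentSpace (𝓡 4) p) :=
  inferInstanceAs (FiniteDimensional ℝ (EuclideanSpace ℝ (Fin 4)))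

/-- The gradient `(grad f)^μ = g^{μν} ∂_ν f`. -/
def grad (f : V → ℝ) (p : V) : TangentSpace (𝓡 4) p :=
  (LinearMap.linearEquivOfInjective (g.flat p) (g.flat_injective p)
    Subspace.dual_finrank_eq.symm).symm (diff f p : TangentSpace (𝓡 4) p →ₗ[ℝ] ℝ)

theorem val_grad (f : V → ℝ) (p : V) (w : TangentSpace (𝓡 4) p) :
    g.val p (g.grad f p) w = diff f p w := by
  have h := LinearEquiv.apply_symm_apply (LinearMap.linearEquivOfInjective (g.flat p)
    (g.flat_injective p) Subspace.dual_finrank_eq.symm)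
    (diff f p : TangentSpace (𝓡 4) p →ₗ[ℝ] ℝ)
  exact congrArg (fun l : Module.Dual ℝ (TangentSpace (𝓡 4) p) => l w) h

/-! ### Double null cone foliations -/

/-- The null geodesic field of the level sets of the optical function `f`,
`L^μ = - g^{μν} ∂_ν f`. -/
def nullGen (f : V → ℝ) (p : V) : TangentSpace (𝓡 4) p := - g.grad f p

/-- The lapse `Ω > 0`, with `g(L, L̲) = -(2 Ω²)⁻¹`. -/
def lapse (u ub : V → ℝ) (p : V) : ℝ :=
  Real.sqrt (-1 / (2 * g.val p (g.nullGen u p) (g.nullGen ub p)))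

/-- `N = 2 Ω² L`, tangent to the generators of the outgoing cones `u = const`. -/
def outgoing (u ub : V → ℝ) (p : V) : TangentSpace (𝓡 4) p :=
  (2 * g.lapse u ub p ^ 2) • g.nullGen u p

/-- `N̲ = 2 Ω² L̲`, tangent to the generators of the incoming cones `u̲ = const`. -/
def incoming (u ub : V → ℝ) (p : V) : TangentSpace (𝓡 4) p :=
  (2 * g.lapse u ub p ^ 2) • g.nullGen ub p

/-- The level sets of `u` and `u̲` form a double null cone foliation: `u` and `u̲` are smooth
solutions of the eikonal equation `g^{μν} ∂_μ w ∂_ν w = 0` and `g(L, L̲) < 0`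
(so that both differentials are nonzero and the lapse is defined). -/
structure IsDoubleNullFoliation (u ub : V → ℝ) : Prop where
  contMDiff_u : ContMDiff (𝓡 4) 𝓘(ℝ) ∞ u
  contMDiff_ub : ContMDiff (𝓡 4) 𝓘(ℝ) ∞ ub
  eikonal_u : ∀ p, g.val p (g.grad u p) (g.grad u p) = 0
  eikonal_ub : ∀ p, g.val p (g.grad ub p) (g.grad ub p) = 0
  val_neg : ∀ p, g.val p (g.nullGen u p) (g.nullGen ub p) < 0

/-- A piece of the initial hypersurface with coordinates `(u̲, ω₀¹, ω₀²)`: a parametrization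
`ι`, on the open set `A`, of a spacelike hypersurface which no incoming generator
meets twice. -/
structure IsInitialPatch (u ub : V → ℝ) (A : Set (ℝ × ℝ × ℝ)) (ι : ℝ × ℝ × ℝ → V) : Prop where
  isOpen : IsOpen A
  contMDiffOn : ContMDiffOn 𝓘(ℝ, ℝ × ℝ × ℝ) (𝓡 4) ∞ ι A
  injOn : InjOn ι A
  ub_eq : ∀ w ∈ A, ub (ι w) = w.1
  spacelike : ∀ w ∈ A, ∀ ξ : TangentSpace 𝓘(ℝ, ℝ × ℝ × ℝ) w, ξ ≠ 0 →
    0 < g.val (ι w) (mfderiv 𝓘(ℝ, ℝ × ℝ × ℝ) (𝓡 4) ι w ξ) (mfderiv 𝓘(ℝ, ℝ × ℝ × ℝ) (𝓡 4) ι w ξ)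
  meets_once : ∀ (γ : ℝ → V) (c d : ℝ), c ≤ d →
    IsMIntegralCurveOn γ (g.incoming u ub) (Icc c d) → γ c ∈ ι '' A → γ d ∈ ι '' A → c = d

/-- The point `p` lies on the incoming generator through `q`; generators, the integral curves
of `N̲`, are parametrized by `u`. -/
def OnIncomingGenerator (u ub : V → ℝ) (q p : V) : Prop :=
  ∃ γ : ℝ → V, IsMIntegralCurveOn γ (g.incoming u ub) (uIcc (u q) (u p)) ∧
    γ (u q) = q ∧ γ (u p) = p

end LorentzMetric

end KerrFoliation

end

/-! The coordinates are carried from the initial patch along the flow of N̲. The eikonal equation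
and the normalization of the lapse give du(N̲) = 1 and du̲(N̲) = 0, so along a generator u is a
parameter and u̲ is constant. The patch is spacelike and N̲ is null, hence N̲ is transverse to it,
and flowing off the patch is a local diffeomorphism (`exists_coordinates_near_patch`). Following the
generators for a fixed time is smooth in both directions (`exists_smooth_transport`), which extends
the patch coordinates to a neighbourhood of every point reached from the patch
(`exists_coordinates_near`). As no generator meets the patch twice, the base point w of a point p is
unique, so these local extensions agree. The map p ↦ (u, w) is then injective with smooth local left
inverses, and this makes it a chart on all of U (`exists_chart`).

In the unshifted coordinates N̲ is ∂/∂u. Adding to the azimuth f(u, u̲, ω¹) = -∫ ω_B(t, ω¹) dt,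
taken from s₀ + 1 to u̲ - u, is a triangular change of coordinates; it keeps the chart and turns N̲
into ∂/∂u + ω_B ∂/∂ω², because ∂f/∂u = ω_B. Smoothness of f rests on Σ R² > 0 for r > 0
(`contDiffAt_kerrOmegaBL`) and on `contDiffOn_intervalIntegral`.

The form of the metric is pointwise linear algebra (`metric_decomposition`). One has g(N̲, ·) = -2Ω²
du̲ and g(N, ·) = -2Ω² du, so the angular coordinate vectors are orthogonal to N and N̲. They are
also orthogonal to the timelike vector L + L̲, which makes γ positive definite.

The smooth local flow comes from applying the inverse function theorem to the integral equation β =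
x + t ∫ v(β) in the Banach space C([-1, 1], E), with (x, t) as parameters
(`exists_smooth_local_flow`). The ingredient is that composition with a smooth map is smooth on
spaces of continuous functions (`contDiff_postcomp`). -/

noncomputable section

namespace KerrFoliation

open Filter Topology

/-! ### Inverse functions, cutoffs, and calculus on spaces of continuous functions -/

section Analysis

/-- Inverse function theorem for `C^∞` maps, with an inverse that is smooth on an open set. -/
theorem exists_openPartialHomeomorph_contDiffOn_symm {E F : Type*}
    [NormedAddCommGroup E] [NormedSpace ℝ E] [CompleteSpace E]
    [NormedAddCommGroup F] [NormedSpace ℝ F]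
    {f : E → F} {O : Set E} (hO : IsOpen O) (hf : ContDiffOn ℝ ∞ f O) {a : E} (ha : a ∈ O)
    (f' : E ≃L[ℝ] F) (hf' : HasFDerivAt f (f' : E →L[ℝ] F) a) :
    ∃ e : OpenPartialHomeomorph E F, a ∈ e.source ∧ e.source ⊆ O ∧ (∀ x, e x = f x) ∧
      ContDiffOn ℝ ∞ e.symm e.target := by
  have hfa : ContDiffAt ℝ ∞ f a := hf.contDiffAt (hO.mem_nhds ha)
  set e₀ := hfa.toOpenPartialHomeomorph f hf' (by simp) with he₀
  have hcont : ContinuousOn (fderiv ℝ f) O := hf.continuousOn_fderiv_of_isOpen hO (by simp)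
  -- The inverse is smooth at the image of each point where the derivative is invertible.
  -- Invertibility is an open condition, so restricting the source to S makes the inverse smooth on
  -- the whole target.
  set S : Set E := O ∩ fderiv ℝ f ⁻¹' (range ((↑) : (E ≃L[ℝ] F) → E →L[ℝ] F)) with hS
  have hSo : IsOpen S := hcont.isOpen_inter_preimage hO ContinuousLinearEquiv.isOpen
  have haS : a ∈ S := ⟨ha, f', hf'.fderiv.symm⟩
  refine ⟨e₀.restrOpen S hSo, ⟨hfa.mem_toOpenPartialHomeomorph_source hf' (by simp), haS⟩,
    fun x hx => hx.2.1, fun x => rfl, ?_⟩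
  intro y hy
  set e := e₀.restrOpen S hSo with he
  have hx : e.symm y ∈ e.source := e.map_target hy
  obtain ⟨f'', hf''⟩ := hx.2.2
  have hd : ContDiffAt ℝ ∞ f (e.symm y) := hf.contDiffAt (hO.mem_nhds hx.2.1)
  refine (e.contDiffAt_symm hy (f₀' := f'') ?_ hd).contDiffWithinAt
  rw [hf'']
  exact (hd.differentiableAt (by simp)).hasFDerivAt

/-- A smooth function on an open set agrees near a compact subset with a globally smooth one. -/
theorem exists_contDiff_eventuallyEq_nhdsSet {E F : Type*}
    [NormedAddCommGroup E] [NormedSpace ℝ E] [FiniteDimensional ℝ E]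
    [NormedAddCommGroup F] [NormedSpace ℝ F] {f : E → F} {O K : Set E}
    (hO : IsOpen O) (hf : ContDiffOn ℝ ∞ f O) (hK : IsCompact K) (hKO : K ⊆ O) :
    ∃ h : E → F, ContDiff ℝ ∞ h ∧ ∀ᶠ x in 𝓝ˢ K, h x = f x := by
  -- The cutoff χ vanishes near the complement of O and equals 1 near K, so χ • f is smooth
  -- everywhere, whatever values f takes outside O.
  obtain ⟨χ, hχ0, hχ1, -⟩ := exists_contMDiffMap_zero_one_nhds_of_isClosed (n := (⊤ : ℕ∞)) 𝓘(ℝ, E)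
    hO.isClosed_compl hK.isClosed (disjoint_left.2 fun x hx hxK => hx (hKO hxK))
  refine ⟨fun x => χ x • f x, ?_, ?_⟩
  · rw [contDiff_iff_contDiffAt]
    intro x
    have hχs : ContDiff ℝ ∞ χ := χ.contMDiff.contDiff
    by_cases hx : x ∈ O
    · exact hχs.contDiffAt.smul (hf.contDiffAt (hO.mem_nhds hx))
    · have : (fun x => χ x • f x) =ᶠ[𝓝 x] fun _ => 0 := by
        filter_upwards [nhds_le_nhdsSet (show x ∈ Oᶜ from hx) hχ0] with y hy
        simp [hy]
      exact contDiffAt_const.congr_of_eventuallyEq this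
  · filter_upwards [hχ1] with x hx
    simp [hx]

universe u

variable {K : Type u} [TopologicalSpace K]

/-- Composition with a continuous map, as a map between spaces of continuous functions. -/
def postcomp {E F : Type u} [TopologicalSpace E] [TopologicalSpace F] (f : E → F)
    (hf : Continuous f) (β : C(K, E)) : C(K, F) := (⟨f, hf⟩ : C(E, F)).comp β

@[simp] theorem postcomp_apply {E F : Type u} [TopologicalSpace E] [TopologicalSpace F]
    (f : E → F) (hf : Continuous f) (β : C(K, E)) (x : K) : postcomp f hf β x = f (β x) := rfl

theorem continuous_postcomp {E F : Type u} [TopologicalSpace E] [TopologicalSpace F] (f : E → F)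
    (hf : Continuous f) : Continuous (postcomp (K := K) f hf) :=
  ContinuousMap.continuous_postcomp _

variable [CompactSpace K]

/-- Pointwise application of a continuous family of operators to continuous maps. -/
def pointwiseApply {E F : Type u} [NormedAddCommGroup E] [NormedSpace ℝ E]
    [NormedAddCommGroup F] [NormedSpace ℝ F] (A : C(K, E →L[ℝ] F)) : C(K, E) →L[ℝ] C(K, F) :=
  LinearMap.mkContinuous
    { toFun := fun β => (⟨fun x => A x (β x), by fun_prop⟩ : C(K, F))
      map_add' := fun _ _ => by ext; simp
      map_smul' := fun _ _ => by ext; simp } ‖A‖ (fun β => by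
    refine (ContinuousMap.norm_le _ (by positivity)).2 fun x => ?_
    exact ((A x).le_opNorm _).trans (mul_le_mul (A.norm_coe_le_norm x) (β.norm_coe_le_norm x)
      (norm_nonneg _) (norm_nonneg A)))

@[simp] theorem pointwiseApply_apply {E F : Type u} [NormedAddCommGroup E] [NormedSpace ℝ E]
    [NormedAddCommGroup F] [NormedSpace ℝ F] (A : C(K, E →L[ℝ] F)) (β : C(K, E)) (x : K) :
    pointwiseApply A β x = A x (β x) := rfl

theorem contDiff_pointwiseApply (E F : Type u) [NormedAddCommGroup E] [NormedSpace ℝ E]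
    [NormedAddCommGroup F] [NormedSpace ℝ F] (n : ℕ∞ω) :
    ContDiff ℝ n (fun A : C(K, E →L[ℝ] F) => pointwiseApply A) := by
  refine (IsLinearMap.with_bound (𝕜 := ℝ) (f := fun A : C(K, E →L[ℝ] F) => pointwiseApply A)
    ⟨fun A B => rfl, fun c A => rfl⟩ 1 fun A => ?_).contDiff
  rw [one_mul]
  exact LinearMap.mkContinuous_norm_le _ (norm_nonneg A) _

/-- The mean value inequality at each point of K, made uniform: the curves β + s • h with s in [0,
1] lie within δ of β in sup norm, and continuity of composition with f' bounds the variation of f'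
along all of them at once. -/
theorem hasFDerivAt_postcomp {E F : Type u} [NormedAddCommGroup E] [NormedSpace ℝ E]
    [NormedAddCommGroup F] [NormedSpace ℝ F] (f : E → F) (f' : E → E →L[ℝ] F)
    (hf : ∀ x, HasFDerivAt f (f' x) x) (hf' : Continuous f')
    (hc : Continuous f) (β : C(K, E)) :
    HasFDerivAt (postcomp (K := K) f hc) (pointwiseApply (postcomp f' hf' β)) β := by
  rw [hasFDerivAt_iff_isLittleO_nhds_zero, Asymptotics.isLittleO_iff]
  intro c hcpos
  have h1 := (continuous_postcomp (K := K) f' hf').continuousAt (x := β)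
  obtain ⟨δ, hδ, h1⟩ := (Metric.continuousAt_iff (α := C(K, E)) (β := C(K, E →L[ℝ] F))).1 h1 c hcpos
  filter_upwards [Metric.ball_mem_nhds (0 : C(K, E)) hδ] with h hh
  rw [mem_ball_zero_iff] at hh
  rw [ContinuousMap.norm_le _ (by positivity)]
  intro x
  have key : ∀ y ∈ segment ℝ (β x) (β x + h x), ‖f' y - f' (β x)‖ ≤ c := by
    intro y hy
    rw [segment_eq_image'] at hy
    obtain ⟨s, hs, rfl⟩ := hy
    have h2 : dist (β + s • h) β < δ := by
      rw [dist_eq_norm, add_sub_cancel_left, norm_smul, Real.norm_of_nonneg hs.1]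
      exact (mul_le_of_le_one_left (norm_nonneg _) hs.2).trans_lt hh
    have h3 := (ContinuousMap.dist_apply_le_dist x).trans (h1 h2).le
    simpa [dist_eq_norm] using h3
  have h4 := (convex_segment (β x) (β x + h x)).norm_image_sub_le_of_norm_hasFDerivWithin_le'
    (f := f) (f' := f') (φ := f' (β x)) (fun y _ => (hf y).hasFDerivWithinAt) key
    (left_mem_segment ℝ _ _) (right_mem_segment ℝ _ _)
  simp only [add_sub_cancel_left] at h4
  calc _ = ‖f (β x + h x) - f (β x) - f' (β x) (h x)‖ := by simp
    _ ≤ c * ‖h x‖ := h4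
    _ ≤ c * ‖h‖ := by gcongr; exact h.norm_coe_le_norm x

/-- Induction on the order: the derivative of composition with f is composition with f' followed by
the bounded linear `pointwiseApply`. The spaces are quantified inside the induction because the step
replaces F by E →L[ℝ] F, and one universe is used so that this space is again admissible. -/
theorem contDiff_postcomp_nat (n : ℕ) : ∀ {E F : Type u} [NormedAddCommGroup E] [NormedSpace ℝ E]
    [NormedAddCommGroup F] [NormedSpace ℝ F] (f : E → F) (_ : ContDiff ℝ n f)
    (hc : Continuous f), ContDiff ℝ n (postcomp (K := K) f hc) := by
  induction n with
  | zero =>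
    intro E F _ _ _ _ f hf hc
    exact contDiff_zero.2 (continuous_postcomp f hc)
  | succ n ih =>
    intro E F _ _ _ _ f hf hc
    push_cast at hf ⊢
    obtain ⟨f', hf', hd⟩ := contDiff_succ_iff_hasFDerivAt.1 hf
    refine contDiff_succ_iff_hasFDerivAt.2 ⟨fun β => pointwiseApply (postcomp f' hf'.continuous β),
      ?_,
      hasFDerivAt_postcomp f f' hd hf'.continuous hc⟩
    exact (contDiff_pointwiseApply E F n).comp (ih f' hf' hf'.continuous)

/-- Composition with a smooth map is smooth on spaces of continuous functions. -/
theorem contDiff_postcomp {E F : Type u} [NormedAddCommGroup E] [NormedSpace ℝ E]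
    [NormedAddCommGroup F] [NormedSpace ℝ F] (f : E → F) (hf : ContDiff ℝ ∞ f) :
    ContDiff ℝ ∞ (postcomp (K := K) f hf.continuous) :=
  contDiff_infty.2 fun n => contDiff_postcomp_nat n f (contDiff_infty.1 hf n) hf.continuous

/-- The primitive vanishing at `0`, as an operator on `C([-1, 1], E)`. -/
def primitive (E : Type*) [NormedAddCommGroup E] [NormedSpace ℝ E] [CompleteSpace E] :
    C(Icc (-1 : ℝ) 1, E) →L[ℝ] C(Icc (-1 : ℝ) 1, E) :=
  have hi : ∀ β : C(Icc (-1 : ℝ) 1, E), Continuous (IccExtend (by norm_num : (-1 : ℝ) ≤ 1) β) :=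
    fun β => β.continuous.Icc_extend'
  LinearMap.mkContinuous
    { toFun := fun β => ⟨fun s => ∫ τ in (0 : ℝ)..s, IccExtend (by norm_num : (-1 : ℝ) ≤ 1) β τ,
        (intervalIntegral.continuous_primitive (fun a b => (hi β).intervalIntegrable a b) 0).comp
          continuous_subtype_val⟩
      map_add' := fun β β' => by
        ext s
        simp only [ContinuousMap.coe_mk, ContinuousMap.add_apply]
        rw [← intervalIntegral.integral_add ((hi β).intervalIntegrable _ _)
          ((hi β').intervalIntegrable _ _)]
        rfl
      map_smul' := fun c β => by
        ext s
        simp only [ContinuousMap.coe_mk, ContinuousMap.smul_apply, RingHom.id_apply]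
        rw [← intervalIntegral.integral_smul]
        rfl } 1 (fun β => by
    rw [ContinuousMap.norm_le _ (by positivity)]
    intro s
    refine (intervalIntegral.norm_integral_le_of_norm_le_const
      (C := ‖β‖) fun τ _ => β.norm_coe_le_norm _).trans ?_
    rw [sub_zero, one_mul]
    exact mul_le_of_le_one_right (norm_nonneg _) (abs_le.2 s.2))

theorem primitive_apply {E : Type*} [NormedAddCommGroup E] [NormedSpace ℝ E] [CompleteSpace E]
    (β : C(Icc (-1 : ℝ) 1, E)) (s : Icc (-1 : ℝ) 1) :
    primitive E β s = ∫ τ in (0 : ℝ)..s, IccExtend (by norm_num : (-1 : ℝ) ≤ 1) β τ := rfl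

end Analysis

/-! ### Smooth local flow in a normed space -/

section LocalFlow

variable {E : Type} [NormedAddCommGroup E] [NormedSpace ℝ E]

/-- The constant maps in `C([-1, 1], E)`. -/
def constMap (E : Type) [NormedAddCommGroup E] [NormedSpace ℝ E] : E →L[ℝ] C(Icc (-1 : ℝ) 1, E) :=
  LinearMap.mkContinuous
    { toFun := fun x => ContinuousMap.const _ x
      map_add' := fun _ _ => rfl
      map_smul' := fun _ _ => rfl } 1 (fun x => by
    refine (ContinuousMap.norm_le _ (by positivity)).2 fun s => ?_
    rw [one_mul]
    exact le_rfl)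

variable [CompleteSpace E]

/-- The map whose zeros `β` are the solutions of `β' = t v(β)`, `β(0) = x`, together with the
parameters `(x, t)`. -/
def flowMap (v : E → E) (hv : Continuous v) (z : (E × ℝ) × C(Icc (-1 : ℝ) 1, E)) :
    (E × ℝ) × C(Icc (-1 : ℝ) 1, E) :=
  (z.1, z.2 - constMap E z.1.1 - z.1.2 • primitive E (postcomp v hv z.2))

theorem contDiff_flowMap (v : E → E) (hv : ContDiff ℝ ∞ v) :
    ContDiff ℝ ∞ (flowMap v hv.continuous) := by
  refine contDiff_fst.prodMk ((contDiff_snd.sub ?_).sub ?_)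
  · exact (constMap E).contDiff.comp (contDiff_fst.comp contDiff_fst)
  · exact (contDiff_snd.comp contDiff_fst).smul
      ((primitive E).contDiff.comp ((contDiff_postcomp v hv).comp contDiff_snd))

/-- At t = 0 the integral term contributes only through the derivative in t, so the derivative is
block triangular with identity diagonal blocks; changing the sign of the off-diagonal block L
inverts it. -/
theorem hasFDerivAt_flowMap (v : E → E) (hv : ContDiff ℝ ∞ v) (x₀ : E) :
    ∃ D : ((E × ℝ) × C(Icc (-1 : ℝ) 1, E)) ≃L[ℝ] ((E × ℝ) × C(Icc (-1 : ℝ) 1, E)),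
      HasFDerivAt (flowMap v hv.continuous) (D : _ →L[ℝ] _) ((x₀, 0), constMap E x₀) := by
  set c := primitive E (postcomp v hv.continuous (constMap E x₀)) with hc
  let L : E × ℝ →L[ℝ] C(Icc (-1 : ℝ) 1, E) :=
    (constMap E).comp (ContinuousLinearMap.fst ℝ E ℝ) +
      (ContinuousLinearMap.snd ℝ E ℝ).smulRight c
  let p1 := ContinuousLinearMap.fst ℝ (E × ℝ) C(Icc (-1 : ℝ) 1, E)
  let p2 := ContinuousLinearMap.snd ℝ (E × ℝ) C(Icc (-1 : ℝ) 1, E)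
  refine ⟨ContinuousLinearEquiv.equivOfInverse (p1.prod (p2 - L.comp p1)) (p1.prod (p2 + L.comp p1))
    (fun z => ?_) (fun z => ?_), ?_⟩
  · simp [p1, p2]
  · simp [p1, p2]
  · have h1 : HasFDerivAt (fun z : (E × ℝ) × C(Icc (-1 : ℝ) 1, E) => constMap E z.1.1)
        ((constMap E).comp ((ContinuousLinearMap.fst ℝ E ℝ).comp p1)) ((x₀, 0), constMap E x₀) :=
      ((constMap E).comp ((ContinuousLinearMap.fst ℝ E ℝ).comp p1)).hasFDerivAt
    have h2 : DifferentiableAt ℝ (fun z : (E × ℝ) × C(Icc (-1 : ℝ) 1, E) =>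
        primitive E (postcomp v hv.continuous z.2)) ((x₀, 0), constMap E x₀) :=
      (((primitive E).contDiff.comp ((contDiff_postcomp v hv).comp contDiff_snd)).differentiable
        (n := ∞) (by simp)) _
    have h3 : HasFDerivAt (fun z : (E × ℝ) × C(Icc (-1 : ℝ) 1, E) => z.1.2)
        ((ContinuousLinearMap.snd ℝ E ℝ).comp p1) ((x₀, 0), constMap E x₀) :=
      ((ContinuousLinearMap.snd ℝ E ℝ).comp p1).hasFDerivAt
    have h4 := (p1.hasFDerivAt (x := ((x₀, (0 : ℝ)), constMap E x₀))).prodMk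
      ((p2.hasFDerivAt.sub h1).sub (h3.smul h2.hasFDerivAt))
    refine h4.congr_fderiv ?_
    refine ContinuousLinearMap.ext fun z => Prod.ext ?_ ?_
    · simp [p1]
    · simp [p1, p2, L, hc, sub_sub]

theorem flowMap_eq_iff (v : E → E) (hv : Continuous v) (x : E) (t : ℝ)
    (β : C(Icc (-1 : ℝ) 1, E)) : flowMap v hv ((x, t), β) = ((x, t), 0) ↔
      ∀ s : Icc (-1 : ℝ) 1,
        β s = x + t • ∫ τ in (0 : ℝ)..s, v (IccExtend (by norm_num : (-1 : ℝ) ≤ 1) β τ) := by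
  rw [flowMap, Prod.mk.injEq, ContinuousMap.ext_iff]
  simp only [true_and]
  refine forall_congr' fun s => ?_
  rw [← sub_eq_zero (a := β s), ← sub_sub]
  rfl

/-- Rescaling the time of a curve in `C([-1, 1], E)`. -/
def rescale (c : ℝ) (β : C(Icc (-1 : ℝ) 1, E)) : C(Icc (-1 : ℝ) 1, E) :=
  ⟨fun s => IccExtend (neg_le_self zero_le_one : (-1 : ℝ) ≤ 1) β (c * s),
    (β.continuous.Icc_extend' (h := neg_le_self zero_le_one)).comp
      (continuous_const.mul continuous_subtype_val)⟩

/-- Substitution in the integral: a solution run at speed t, followed for the fraction c of its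
time, is a solution run at speed c t. The bound on c keeps the rescaled time inside [-1, 1]. -/
theorem flowMap_rescale (v : E → E) (hv : Continuous v) (x : E) (t c : ℝ) (hc : |c| ≤ 1)
    (β : C(Icc (-1 : ℝ) 1, E)) (h : flowMap v hv ((x, t), β) = ((x, t), 0)) :
    flowMap v hv ((x, c * t), rescale c β) = ((x, c * t), 0) := by
  rw [flowMap_eq_iff] at h ⊢
  intro s
  have hcs : c * s ∈ Icc (-1 : ℝ) 1 := by
    rw [mem_Icc, ← abs_le, abs_mul]
    exact mul_le_one₀ hc (abs_nonneg _) (abs_le.2 s.2)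
  have h1 : rescale c β s = β ⟨c * s, hcs⟩ := IccExtend_of_mem _ _ hcs
  rw [h1, h, mul_comm c t, mul_smul]
  congr 1
  have h2 := intervalIntegral.smul_integral_comp_mul_left (a := 0) (b := (s : ℝ))
    (fun τ => v (IccExtend (by norm_num : (-1 : ℝ) ≤ 1) β τ)) c
  rw [mul_zero] at h2
  rw [← h2]
  congr 2
  refine intervalIntegral.integral_congr (E := E) fun τ hτ => ?_
  have hτ' : τ ∈ Icc (-1 : ℝ) 1 :=
    (uIcc_subset_Icc (by norm_num) s.2) hτ
  rw [IccExtend_of_mem _ (rescale c β) hτ']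
  rfl

/-- A smooth vector field has a smooth local flow. -/
theorem exists_smooth_local_flow [FiniteDimensional ℝ E] {v : E → E} {O : Set E} (hO : IsOpen O)
    (hv : ContDiffOn ℝ ∞ v O) {x₀ : E} (hx₀ : x₀ ∈ O) :
    ∃ ε > 0, ∃ U : Set E, IsOpen U ∧ x₀ ∈ U ∧ ∃ Fl : E × ℝ → E,
      ContDiffOn ℝ ∞ Fl (U ×ˢ Ioo (-ε) ε) ∧ ∀ x ∈ U, Fl (x, 0) = x ∧
        ∀ t ∈ Ioo (-ε) ε, Fl (x, t) ∈ O ∧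
          HasDerivAt (fun s => Fl (x, s)) (v (Fl (x, t))) t := by
  obtain ⟨w, hw, hwv⟩ := exists_contDiff_eventuallyEq_nhdsSet hO hv isCompact_singleton
    (singleton_subset_iff.2 hx₀)
  rw [nhdsSet_singleton] at hwv
  obtain ⟨D, hD⟩ := hasFDerivAt_flowMap w hw x₀
  obtain ⟨e, hes, -, hee, hesm⟩ := exists_openPartialHomeomorph_contDiffOn_symm isOpen_univ
    (contDiff_flowMap w hw).contDiffOn (mem_univ _) D hD
  have hz₀ : e ((x₀, 0), constMap E x₀) = ((x₀, 0), 0) := by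
    rw [hee, flowMap]; simp
  set j : E × ℝ → (E × ℝ) × C(Icc (-1 : ℝ) 1, E) := fun y => (y, 0) with hj
  have hjs : ContDiff ℝ ∞ j := contDiff_id.prodMk contDiff_const
  set B : E × ℝ → C(Icc (-1 : ℝ) 1, E) := fun y => (e.symm (j y)).2 with hB
  set T : Set (E × ℝ) := j ⁻¹' e.target with hT
  have hTo : IsOpen T := e.open_target.preimage hjs.continuous
  have hx₀T : (x₀, (0 : ℝ)) ∈ T := by
    change ((x₀, (0 : ℝ)), (0 : C(Icc (-1 : ℝ) 1, E))) ∈ e.target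
    rw [← hz₀]; exact e.map_source hes
  have hBs : ContDiffOn ℝ ∞ B T := contDiff_snd.comp_contDiffOn
    (hesm.comp hjs.contDiffOn (fun y hy => hy))
  have hB0 : B (x₀, 0) = constMap E x₀ := by
    change (e.symm ((x₀, (0 : ℝ)), (0 : C(Icc (-1 : ℝ) 1, E)))).2 = _
    rw [← hz₀, e.left_inv hes]
  have hBeq : ∀ y ∈ T, flowMap w hw.continuous (y, B y) = (y, 0) := by
    intro y hy
    have h1 : flowMap w hw.continuous (e.symm (j y)) = (y, 0) := by
      rw [← hee]; exact e.right_inv hy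
    have h2 : (e.symm (j y)).1 = y := congrArg Prod.fst h1
    rw [← h1, hB]
    congr 1
    exact Prod.ext h2.symm rfl
  obtain ⟨δ, hδ, hδs⟩ := Metric.isOpen_iff.1 e.open_source _ hes
  obtain ⟨δ', hδ', hδO⟩ := Metric.mem_nhds_iff.1 (hwv.and (hO.mem_nhds hx₀))
  have hnear : ∀ᶠ y in 𝓝 (x₀, (0 : ℝ)), y ∈ T ∧ dist (B y) (constMap E x₀) < min δ δ' := by
    refine Filter.Eventually.and (hTo.mem_nhds hx₀T) ?_
    have hc : ContinuousAt B (x₀, 0) := (hBs.continuousOn).continuousAt (hTo.mem_nhds hx₀T)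
    have := hc (Metric.ball_mem_nhds _ (lt_min hδ hδ'))
    rwa [hB0] at this
  obtain ⟨ρ, hρ, hρs⟩ := Metric.eventually_nhds_iff.1 hnear
  set r := min ρ δ with hr
  have hrpos : 0 < r := lt_min hρ hδ
  -- The time-t flow is the endpoint at parameter 1 of the solution run at speed t. Halving r puts
  -- the closed range |t| ≤ r / 2 inside the region controlled by ρ and δ.
  refine ⟨r / 2, half_pos hrpos, Metric.ball x₀ r, Metric.isOpen_ball, Metric.mem_ball_self hrpos,
    fun y => B y ⟨1, by norm_num⟩, ?_, ?_⟩
  · have hsub : Metric.ball x₀ r ×ˢ Ioo (-(r / 2)) (r / 2) ⊆ T := by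
      rintro ⟨x, t⟩ ⟨hx, ht⟩
      refine (hρs ?_).1
      rw [Prod.dist_eq, max_lt_iff, Real.dist_eq, sub_zero, abs_lt]
      simp only [Metric.mem_ball, mem_Ioo] at hx ht
      have := min_le_left ρ δ
      exact ⟨by linarith, by constructor <;> linarith⟩
    exact (ContinuousMap.evalCLM ℝ (⟨1, by norm_num⟩ : Icc (-1 : ℝ) 1)).contDiff.comp_contDiffOn
      (hBs.mono hsub)
  · intro x hx
    have hx' : dist x x₀ < r := hx
    have hrρ : r ≤ ρ := min_le_left ρ δ
    have hrδ : r ≤ δ := min_le_right ρ δ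
    set ε := r / 2 with hε
    have hεpos : 0 < ε := half_pos hrpos
    have hloc : ∀ t, |t| ≤ ε → (x, t) ∈ T ∧ dist (B (x, t)) (constMap E x₀) < min δ δ' := by
      intro t ht
      refine hρs ?_
      rw [Prod.dist_eq, max_lt_iff, Real.dist_eq, sub_zero]
      exact ⟨by linarith, by linarith⟩
    set β := B (x, ε) with hβ
    obtain ⟨hxT, hβd⟩ := hloc ε (by rw [abs_of_pos hεpos])
    have hβeq : flowMap w hw.continuous ((x, ε), β) = ((x, ε), 0) := hBeq _ hxT
    -- `B` supplies a separate curve for each t, and to differentiate in t they must come from a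
    -- single one. The curve for t and the rescaled curve for ε solve the same equation near the
    -- constant map, where `e` is injective, so they coincide.
    have hscale : ∀ t, |t| ≤ ε → B (x, t) = rescale (t / ε) β := by
      intro t ht
      obtain ⟨htT, htd⟩ := hloc t ht
      have hc : |t / ε| ≤ 1 := by rw [abs_div, abs_of_pos hεpos]; exact (div_le_one hεpos).2 ht
      have h1 := flowMap_rescale w hw.continuous x ε (t / ε) hc β hβeq
      rw [div_mul_cancel₀ _ hεpos.ne'] at h1
      have h2 := hBeq _ htT
      have hd1 : dist (rescale (t / ε) β) (constMap E x₀) ≤ dist β (constMap E x₀) := by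
        refine (ContinuousMap.dist_le dist_nonneg).2 fun s => ?_
        exact ContinuousMap.dist_apply_le_dist (f := β) (g := constMap E x₀) (projIcc _ _ _ _)
      have hmem : ∀ β' : C(Icc (-1 : ℝ) 1, E), dist β' (constMap E x₀) < δ →
          ((x, t), β') ∈ e.source := by
        intro β' hβ'
        refine hδs ?_
        rw [Metric.mem_ball, Prod.dist_eq, Prod.dist_eq, max_lt_iff, max_lt_iff, Real.dist_eq,
          sub_zero]
        exact ⟨⟨by linarith, by simp only; linarith⟩, hβ'⟩
      have h3 := e.injOn (hmem _ (htd.trans_le (min_le_left _ _)))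
        (hmem _ (hd1.trans_lt (hβd.trans_le (min_le_left _ _)))) (by rw [hee, hee, h1, h2])
      exact congrArg Prod.snd h3
    have hone : (-1 : ℝ) ≤ 1 := by norm_num
    have hFl : ∀ t, |t| ≤ ε → B (x, t) ⟨1, by norm_num⟩ = IccExtend hone β (t / ε) := by
      intro t ht
      rw [hscale t ht]
      change IccExtend hone β (t / ε * 1) = _
      rw [mul_one]
    have hβs := (flowMap_eq_iff w hw.continuous x ε β).1 hβeq
    have hform : ∀ t, |t| ≤ ε → IccExtend hone β (t / ε) =
        x + ε • ∫ τ in (0 : ℝ)..(t / ε), w (IccExtend hone β τ) := by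
      intro t ht
      have hc : t / ε ∈ Icc (-1 : ℝ) 1 := by
        rw [mem_Icc, ← abs_le, abs_div, abs_of_pos hεpos]; exact (div_le_one hεpos).2 ht
      rw [IccExtend_of_mem _ _ hc, hβs]
    refine ⟨?_, fun t ht => ?_⟩
    · simp only
      rw [hFl 0 (by simpa using hεpos.le), hform 0 (by simpa using hεpos.le)]
      simp
    · have ht' : |t| ≤ ε := (abs_lt.2 ht).le
      have hd : dist (B (x, t) ⟨1, by norm_num⟩) x₀ < δ' :=
        (ContinuousMap.dist_apply_le_dist (f := B (x, t)) (g := constMap E x₀) _).trans_lt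
          ((hloc t ht').2.trans_le (min_le_right _ _))
      obtain ⟨hwt, hOt⟩ := hδO hd
      refine ⟨hOt, ?_⟩
      have hcont : Continuous fun τ => w (IccExtend hone β τ) :=
        hw.continuous.comp β.continuous.Icc_extend'
      have h1 : HasDerivAt (fun s => x + ε • ∫ τ in (0 : ℝ)..(s / ε), w (IccExtend hone β τ))
          (ε • ((1 / ε) • w (IccExtend hone β (t / ε)))) t := by
        refine HasDerivAt.const_add _ (HasDerivAt.const_smul _ ?_)
        exact (intervalIntegral.integral_hasDerivAt_right (hcont.intervalIntegrable _ _)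
          hcont.aestronglyMeasurable.stronglyMeasurableAtFilter hcont.continuousAt).scomp t
          ((hasDerivAt_id t).div_const ε)
      rw [smul_smul, mul_one_div_cancel hεpos.ne', one_smul, ← hFl t ht', hwt] at h1
      refine h1.congr_of_eventuallyEq ?_
      filter_upwards [Ioo_mem_nhds ht.1 ht.2] with s hs
      have hs' : |s| ≤ ε := (abs_lt.2 hs).le
      rw [hFl s hs', hform s hs']

end LocalFlow

/-! ### Smooth local flow on a manifold -/

section ManifoldFlow

variable {E : Type} [NormedAddCommGroup E] [NormedSpace ℝ E] [FiniteDimensional ℝ E]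
  {H : Type*} [TopologicalSpace H] {I : ModelWithCorners ℝ E H} [I.Boundaryless]
  {M : Type*} [TopologicalSpace M] [ChartedSpace H M] [IsManifold I ∞ M]
  {v : (x : M) → TangentSpace I x}

/-- A smooth vector field on a manifold without boundary has a smooth local flow. -/
theorem exists_smooth_local_flow_manifold
    (hv : ContMDiff I I.tangent ∞ (fun x => (⟨x, v x⟩ : TangentBundle I M))) (q : M) :
    ∃ ε > 0, ∃ U : Set M, IsOpen U ∧ q ∈ U ∧ ∃ Fl : M × ℝ → M,
      ContMDiffOn (I.prod 𝓘(ℝ)) I ∞ Fl (U ×ˢ Ioo (-ε) ε) ∧ ∀ p ∈ U, Fl (p, 0) = p ∧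
        IsMIntegralCurveOn (fun t => Fl (p, t)) v (Ioo (-ε) ε) := by
  have : IsManifold I 1 M := IsManifold.of_le (n := ∞) (by simp)
  have : CompleteSpace E := FiniteDimensional.complete ℝ E
  set φ := extChartAt I q with hφ
  have hφT : IsOpen φ.target := isOpen_extChartAt_target q
  have hsrc : φ.source = (chartAt H q).source := extChartAt_source I q
  set w : E → E := fun y => mfderiv I 𝓘(ℝ, E) φ (φ.symm y) (v (φ.symm y)) with hw
  have hws : ContDiffOn ℝ ∞ w φ.target := by
    rw [← contMDiffOn_iff_contDiffOn]
    have h1 := ((trivializationAt E (TangentSpace I : M → Type _) q).contMDiffOn_section_baseSet_iff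
      (IB := I) (n := ∞) (s := v)).1 hv.contMDiffOn
    have h2 := h1.comp (contMDiffOn_extChartAt_symm (I := I) (n := ∞) q) (fun y hy => by
      have := φ.map_target hy
      rwa [hsrc] at this)
    refine h2.congr fun y hy => ?_
    have hy' : φ.symm y ∈ (chartAt H q).source := hsrc ▸ φ.map_target hy
    -- The tangent bundle trivialization at q is the derivative of the chart, so the smooth
    -- trivialized section is the chart expression `w` of the field.
    refine (DFunLike.congr_fun (TangentBundle.continuousLinearMapAt_trivializationAt
      (I := I) hy') (v (φ.symm y))).symm.trans ?_
    exact Bundle.Trivialization.continuousLinearMapAt_apply_of_mem (R := ℝ)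
      (trivializationAt E (TangentSpace I : M → Type _) q) hy' _
  obtain ⟨ε, hε, U, hU, hqU, F, hF, hFl⟩ := exists_smooth_local_flow hφT hws
    (mem_extChartAt_target (I := I) q)
  have hsmooth : ContMDiffOn I 𝓘(ℝ, E) ∞ φ φ.source := hsrc ▸ contMDiffOn_extChartAt
  refine ⟨ε, hε, φ.source ∩ φ ⁻¹' U,
    hsmooth.continuousOn.isOpen_inter_preimage (isOpen_extChartAt_source q) hU,
    ⟨mem_extChartAt_source q, hqU⟩, fun z => φ.symm (F (φ z.1, z.2)), ?_, ?_⟩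
  · refine (contMDiffOn_extChartAt_symm (I := I) (n := ∞) q).comp
      (t := φ.target) ((contMDiffOn_iff_contDiffOn.2 hF).comp (t := U ×ˢ Ioo (-ε) ε) ?_ ?_) ?_
    · exact (hsmooth.comp contMDiffOn_fst (fun z hz => hz.1.1)).prodMk_space contMDiffOn_snd
    · exact fun z hz => ⟨hz.1.2, hz.2⟩
    · exact fun z hz => ((hFl _ hz.1.2).2 _ hz.2).1
  · rintro p ⟨hp, hpU⟩
    obtain ⟨h0, h1⟩ := hFl _ hpU
    refine ⟨?_, fun t ht => ?_⟩
    · simp only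
      rw [h0, φ.left_inv hp]
    · obtain ⟨hT, hd⟩ := h1 t ht
      have hsymm : MDifferentiableAt 𝓘(ℝ, E) I φ.symm (F (φ p, t)) :=
        ((contMDiffOn_extChartAt_symm (I := I) (n := ∞) q).contMDiffAt
          (hφT.mem_nhds hT)).mdifferentiableAt (by simp)
      have h2 := hsymm.hasMFDerivAt.comp t hd.hasFDerivAt.hasMFDerivAt
      refine (HasMFDerivAt.hasMFDerivWithinAt ?_)
      refine h2.congr_mfderiv ?_
      have h3 := mfderivWithin_extChartAt_symm_comp_mfderiv_extChartAt (I := I) hT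
      rw [I.range_eq_univ, mfderivWithin_univ] at h3
      have h4 : mfderiv 𝓘(ℝ, E) I φ.symm (F (φ p, t)) (w (F (φ p, t))) =
        v (φ.symm (F (φ p, t))) := DFunLike.congr_fun h3 _
      refine ContinuousLinearMap.ext fun s : ℝ => ?_
      exact (map_smul (mfderiv 𝓘(ℝ, E) I φ.symm (F (φ p, t))) s (w (F (φ p, t)))).trans
        (congrArg (s • ·) h4)

end ManifoldFlow

/-! ### Concatenation of integral curves -/

section Gluing

variable {E : Type*} [NormedAddCommGroup E] [NormedSpace ℝ E]
  {H : Type*} [TopologicalSpace H] {I : ModelWithCorners ℝ E H}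
  {M : Type*} [TopologicalSpace M] [ChartedSpace H M] {v : (x : M) → TangentSpace I x}

theorem _root_.IsMIntegralCurveOn.congr_eqOn {γ γ' : ℝ → M} {s : Set ℝ}
    (h : IsMIntegralCurveOn γ v s) (he : EqOn γ' γ s) : IsMIntegralCurveOn γ' v s := by
  intro t ht
  have h1 := (h t ht).congr_of_eventuallyEq (eventually_nhdsWithin_of_forall he) (he ht)
  have h2 : v (γ t) = v (γ' t) := by rw [he ht]
  refine h1.congr_mfderiv ?_
  exact congrArg (fun z : E => ContinuousLinearMap.smulRight (1 : ℝ →L[ℝ] ℝ) z) h2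

/-- Two integral curves on adjacent intervals with a common end point form an integral curve. -/
theorem _root_.IsMIntegralCurveOn.glue {γ₁ γ₂ : ℝ → M} {a b c : ℝ} (hab : a ≤ b) (hbc : b ≤ c)
    (h₁ : IsMIntegralCurveOn γ₁ v (Icc a b)) (h₂ : IsMIntegralCurveOn γ₂ v (Icc b c))
    (hb : γ₁ b = γ₂ b) :
    ∃ γ : ℝ → M, EqOn γ γ₁ (Icc a b) ∧ EqOn γ γ₂ (Icc b c) ∧ IsMIntegralCurveOn γ v (Icc a c) := by
  set γ : ℝ → M := fun t => if t ≤ b then γ₁ t else γ₂ t with hγ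
  have e₁ : EqOn γ γ₁ (Icc a b) := fun t ht => if_pos ht.2
  have e₂ : EqOn γ γ₂ (Icc b c) := by
    intro t ht
    rcases ht.1.eq_or_lt with rfl | h
    · simp [hγ, hb]
    · simp [hγ, h.not_ge]
  refine ⟨γ, e₁, e₂, fun t ht => ?_⟩
  have g₁ := h₁.congr_eqOn e₁
  have g₂ := h₂.congr_eqOn e₂
  rcases lt_trichotomy t b with h | rfl | h
  · refine (g₁ t ⟨ht.1, h.le⟩).mono_of_mem_nhdsWithin ?_
    filter_upwards [self_mem_nhdsWithin, mem_nhdsWithin_of_mem_nhds (Iio_mem_nhds h)] with s hs hs'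
    exact ⟨hs.1, le_of_lt hs'⟩
  -- At the junction both one-sided derivatives equal the field at the common point, so they combine
  -- into a derivative within the union.
  · rw [← Icc_union_Icc_eq_Icc hab hbc]
    exact (g₁ t ⟨hab, le_rfl⟩).union (g₂ t ⟨le_rfl, hbc⟩)
  · refine (g₂ t ⟨h.le, ht.2⟩).mono_of_mem_nhdsWithin ?_
    filter_upwards [self_mem_nhdsWithin, mem_nhdsWithin_of_mem_nhds (Ioi_mem_nhds h)] with s hs hs'
    exact ⟨le_of_lt hs', hs.2⟩

theorem _root_.IsMIntegralCurveOn.shift {γ : ℝ → M} {s s' : Set ℝ} {c : ℝ}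
    (h : IsMIntegralCurveOn γ v s) (hs : ∀ t ∈ s', t + c ∈ s) :
    IsMIntegralCurveOn (fun t => γ (t + c)) v s' :=
  (h.comp_add c).mono hs

variable (v) in
/-- The points `p`, `q` are the points with parameters `a`, `b` of an integral curve of `v`. -/
def Joined (a b : ℝ) (p q : M) : Prop :=
  ∃ γ : ℝ → M, IsMIntegralCurveOn γ v (uIcc a b) ∧ γ a = p ∧ γ b = q

theorem Joined.symm {a b : ℝ} {p q : M} (h : Joined v a b p q) : Joined v b a q p := by
  obtain ⟨γ, h, h1, h2⟩ := h
  exact ⟨γ, by rwa [uIcc_comm], h2, h1⟩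

theorem Joined.shift {a b : ℝ} {p q : M} (h : Joined v a b p q) (c : ℝ) :
    Joined v (a + c) (b + c) p q := by
  obtain ⟨γ, h, h1, h2⟩ := h
  refine ⟨fun t => γ (t + -c), h.shift fun t ht => ?_, by simpa, by simpa⟩
  rcases le_total a b with hab | hab
  · rw [uIcc_of_le hab]
    rw [uIcc_of_le (by linarith)] at ht
    constructor <;> linarith [ht.1, ht.2]
  · rw [uIcc_of_ge hab]
    rw [uIcc_of_ge (by linarith)] at ht
    constructor <;> linarith [ht.1, ht.2]

theorem joined_of_mem {γ : ℝ → M} {s : Set ℝ} (h : IsMIntegralCurveOn γ v s) {a b : ℝ}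
    (hs : uIcc a b ⊆ s) : Joined v a b (γ a) (γ b) := ⟨γ, h.mono hs, rfl, rfl⟩

theorem Joined.eq_of_self {a : ℝ} {p q : M} (h : Joined v a a p q) : p = q := by
  obtain ⟨γ, -, rfl, rfl⟩ := h
  rfl

theorem Joined.trans_of_le {a b c : ℝ} {p q r : M} (hab : a ≤ b) (hbc : b ≤ c)
    (h₁ : Joined v a b p q) (h₂ : Joined v b c q r) : Joined v a c p r := by
  obtain ⟨γ₁, h1, h1a, h1b⟩ := h₁
  obtain ⟨γ₂, h2, h2a, h2b⟩ := h₂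
  rw [uIcc_of_le hab] at h1
  rw [uIcc_of_le hbc] at h2
  obtain ⟨γ, e1, e2, h⟩ := h1.glue hab hbc h2 (h1b.trans h2a.symm)
  exact ⟨γ, by rwa [uIcc_of_le (hab.trans hbc)], by rw [e1 ⟨le_rfl, hab⟩, h1a],
    by rw [e2 ⟨hbc, le_rfl⟩, h2b]⟩

end Gluing

/-! ### Uniqueness of integral curves on compact intervals -/

section Uniqueness

variable {E : Type} [NormedAddCommGroup E] [NormedSpace ℝ E] [FiniteDimensional ℝ E]
  {H : Type*} [TopologicalSpace H] {I : ModelWithCorners ℝ E H} [I.Boundaryless]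
  {M : Type*} [TopologicalSpace M] [ChartedSpace H M] [IsManifold I ∞ M]
  {v : (x : M) → TangentSpace I x}

theorem exists_integralCurve_Icc
    (hv : ContMDiff I I.tangent ∞ (fun x => (⟨x, v x⟩ : TangentBundle I M))) (q : M) (a : ℝ) :
    ∃ ε > 0, ∃ γ : ℝ → M, γ a = q ∧ IsMIntegralCurveOn γ v (Icc (a - ε) (a + ε)) := by
  obtain ⟨ε, hε, U, -, hq, Fl, -, h⟩ := exists_smooth_local_flow_manifold hv q
  obtain ⟨h0, h1⟩ := h q hq
  refine ⟨ε / 2, half_pos hε, fun t => Fl (q, t + -a), by simpa using h0, h1.shift fun t ht => ?_⟩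
  constructor <;> linarith [ht.1, ht.2]

/-- An integral curve on a compact interval extends to a neighbourhood of the interval. -/
theorem exists_extend_integralCurve
    (hv : ContMDiff I I.tangent ∞ (fun x => (⟨x, v x⟩ : TangentBundle I M)))
    {γ : ℝ → M} {a b : ℝ} (hab : a ≤ b) (h : IsMIntegralCurveOn γ v (Icc a b)) :
    ∃ ε > 0, ∃ γ' : ℝ → M, EqOn γ' γ (Icc a b) ∧
      IsMIntegralCurveOn γ' v (Ioo (a - ε) (b + ε)) := by
  obtain ⟨ε₁, hε₁, α, hα, hα'⟩ := exists_integralCurve_Icc hv (γ a) a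
  obtain ⟨ε₂, hε₂, β, hβ, hβ'⟩ := exists_integralCurve_Icc hv (γ b) b
  obtain ⟨γ₁, e1, e2, h1⟩ := IsMIntegralCurveOn.glue (by linarith) hab
    (hα'.mono (Icc_subset_Icc_right (by linarith))) h hα
  obtain ⟨γ₂, e3, e4, h2⟩ := IsMIntegralCurveOn.glue (by linarith) (by linarith) h1
    (hβ'.mono (Icc_subset_Icc_left (by linarith)))
    (by rw [e2 ⟨hab, le_rfl⟩, hβ])
  refine ⟨min ε₁ ε₂, lt_min hε₁ hε₂, γ₂, fun t ht => ?_, h2.mono fun t ht => ?_⟩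
  · rw [e3 ⟨by linarith [ht.1], ht.2⟩, e2 ht]
  · have := min_le_left ε₁ ε₂
    have := min_le_right ε₁ ε₂
    constructor <;> linarith [ht.1, ht.2]

variable [T2Space M]

/-- Both curves are prolonged slightly past the endpoints, which reduces the claim to uniqueness on
an open interval and also covers t₀ at an endpoint. -/
theorem eqOn_of_isMIntegralCurveOn_Icc
    (hv : ContMDiff I I.tangent ∞ (fun x => (⟨x, v x⟩ : TangentBundle I M)))
    {γ γ' : ℝ → M} {a b t₀ : ℝ} (ht₀ : t₀ ∈ Icc a b) (h : IsMIntegralCurveOn γ v (Icc a b))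
    (h' : IsMIntegralCurveOn γ' v (Icc a b)) (he : γ t₀ = γ' t₀) : EqOn γ γ' (Icc a b) := by
  have : IsManifold I 1 M := IsManifold.of_le (n := ∞) (by simp)
  have : CompleteSpace E := FiniteDimensional.complete ℝ E
  have hab := ht₀.1.trans ht₀.2
  obtain ⟨ε₁, hε₁, α, e1, hα⟩ := exists_extend_integralCurve hv hab h
  obtain ⟨ε₂, hε₂, β, e2, hβ⟩ := exists_extend_integralCurve hv hab h'
  have hm1 := min_le_left ε₁ ε₂
  have hm2 := min_le_right ε₁ ε₂
  have hm := lt_min hε₁ hε₂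
  have key := isMIntegralCurveOn_Ioo_eqOn_of_contMDiff_boundaryless
    (a := a - min ε₁ ε₂) (b := b + min ε₁ ε₂) (t₀ := t₀)
    ⟨by linarith [ht₀.1], by linarith [ht₀.2]⟩ (hv.of_le (by simp))
    (hα.mono (Ioo_subset_Ioo (by linarith) (by linarith)))
    (hβ.mono (Ioo_subset_Ioo (by linarith) (by linarith))) (by rw [e1 ht₀, e2 ht₀, he])
  intro t ht
  rw [← e1 ht, ← e2 ht]
  exact key ⟨by linarith [ht.1], by linarith [ht.2]⟩

theorem Joined.unique
    (hv : ContMDiff I I.tangent ∞ (fun x => (⟨x, v x⟩ : TangentBundle I M)))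
    {a b : ℝ} {p q q' : M} (h : Joined v a b p q) (h' : Joined v a b p q') : q = q' := by
  obtain ⟨γ, h, ha, hb⟩ := h
  obtain ⟨γ', h', ha', hb'⟩ := h'
  rw [← hb, ← hb']
  exact eqOn_of_isMIntegralCurveOn_Icc hv left_mem_uIcc h h' (ha.trans ha'.symm) right_mem_uIcc

/-- By uniqueness the curve from p to q is an initial piece of the curve from p to r; what is left
over joins q to r. -/
theorem Joined.sub_right
    (hv : ContMDiff I I.tangent ∞ (fun x => (⟨x, v x⟩ : TangentBundle I M)))
    {a b c : ℝ} {p q r : M} (hb : b ∈ uIcc a c) (h : Joined v a b p q) (h' : Joined v a c p r) :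
    Joined v b c q r := by
  obtain ⟨γ, hγ, ha, hc⟩ := h'
  have h1 : Joined v a b p (γ b) :=
    ⟨γ, hγ.mono (uIcc_subset_uIcc left_mem_uIcc hb), ha, rfl⟩
  obtain rfl := h.unique hv h1
  exact ⟨γ, hγ.mono (uIcc_subset_uIcc hb right_mem_uIcc), rfl, hc⟩

/-- Parameters may run in either direction. If the two pieces run the same way they are glued; if
they run opposite ways they overlap, and the shorter is cancelled from the longer. -/
theorem Joined.trans
    (hv : ContMDiff I I.tangent ∞ (fun x => (⟨x, v x⟩ : TangentBundle I M)))
    {a b c : ℝ} {p q r : M} (h₁ : Joined v a b p q) (h₂ : Joined v b c q r) :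
    Joined v a c p r := by
  rcases le_total a b with hab | hab <;> rcases le_total b c with hbc | hbc
  · exact h₁.trans_of_le hab hbc h₂
  · rcases le_total a c with hac | hac
    · exact (h₂.sub_right hv (mem_uIcc.2 (Or.inr ⟨hac, hbc⟩)) h₁.symm).symm
    · exact (h₁.symm.sub_right hv (mem_uIcc.2 (Or.inr ⟨hac, hab⟩)) h₂)
  · rcases le_total a c with hac | hac
    · exact (h₁.symm.sub_right hv (mem_uIcc.2 (Or.inl ⟨hab, hac⟩)) h₂)
    · exact (h₂.sub_right hv (mem_uIcc.2 (Or.inl ⟨hbc, hac⟩)) h₁.symm).symm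
  · exact (h₂.symm.trans_of_le hbc hab h₁.symm).symm

end Uniqueness

/-! ### Smooth transport for a fixed time along integral curves -/

section Transport

variable {E : Type} [NormedAddCommGroup E] [NormedSpace ℝ E] [FiniteDimensional ℝ E]
  {H : Type*} [TopologicalSpace H] {I : ModelWithCorners ℝ E H} [I.Boundaryless]
  {M : Type*} [TopologicalSpace M] [ChartedSpace H M] [IsManifold I ∞ M] [T2Space M]
  {v : (x : M) → TangentSpace I x}

/-- Following the integral curves of a smooth vector field for a fixed time is a smooth map near
every point whose integral curve exists for that time. -/
theorem exists_smooth_transport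
    (hv : ContMDiff I I.tangent ∞ (fun x => (⟨x, v x⟩ : TangentBundle I M)))
    {a b : ℝ} {p q : M} (h : Joined v a b p q) :
    ∃ O : Set M, IsOpen O ∧ p ∈ O ∧ ∃ ψ : M → M, ContMDiffOn I I ∞ ψ O ∧ ψ p = q ∧
      ∀ p' ∈ O, Joined v a b p' (ψ p') := by
  obtain ⟨γ, hγ, rfl, rfl⟩ := h
  -- Smooth transport between two parameters of γ is a transitive relation that holds, in both
  -- directions, between sufficiently close parameters by the local flow; connectedness of the
  -- interval extends it to the endpoints.
  refine (isPreconnected_uIcc (a := a) (b := b)).induction₂' (fun x y => ∃ O : Set M, IsOpen O ∧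
    γ x ∈ O ∧ ∃ ψ : M → M, ContMDiffOn I I ∞ ψ O ∧ ψ (γ x) = γ y ∧
      ∀ p' ∈ O, Joined v x y p' (ψ p')) ?_ ?_ left_mem_uIcc right_mem_uIcc
  · intro x hx
    obtain ⟨ε, hε, U, hU, hxU, Fl, hFl, hFl'⟩ := exists_smooth_local_flow_manifold hv (γ x)
    have hslice : ∀ t ∈ Ioo (-ε) ε, ContMDiffOn I I ∞ (fun p => Fl (p, t)) U := fun t ht =>
      hFl.comp (contMDiffOn_id.prodMk contMDiffOn_const) (fun p hp => ⟨hp, ht⟩)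
    have hjoin : ∀ p ∈ U, ∀ x y : ℝ, y - x ∈ Ioo (-ε) ε → Joined v x y p (Fl (p, y - x)) := by
      intro p hp x y hxy
      have h1 : Joined v 0 (y - x) (Fl (p, 0)) (Fl (p, y - x)) :=
        joined_of_mem (hFl' p hp).2
          (OrdConnected.uIcc_subset ordConnected_Ioo ⟨neg_lt_zero.2 hε, hε⟩ hxy)
      rw [(hFl' p hp).1] at h1
      simpa using h1.shift x
    have hγU : ∀ᶠ y in 𝓝[uIcc a b] x, γ y ∈ U :=
      (hγ.continuousWithinAt hx).preimage_mem_nhdsWithin (hU.mem_nhds hxU)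
    filter_upwards [hγU, self_mem_nhdsWithin,
      mem_nhdsWithin_of_mem_nhds (Ioo_mem_nhds (a := x - ε) (b := x + ε) (by linarith)
        (by linarith))] with y hyU hys hyε
    have hyx : y - x ∈ Ioo (-ε) ε := ⟨by linarith [hyε.1], by linarith [hyε.2]⟩
    have hxy : x - y ∈ Ioo (-ε) ε := ⟨by linarith [hyε.2], by linarith [hyε.1]⟩
    have hj : ∀ s ∈ uIcc a b, ∀ t ∈ uIcc a b, Joined v s t (γ s) (γ t) := fun s hs t ht =>
      joined_of_mem hγ (uIcc_subset_uIcc hs ht)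
    exact ⟨⟨U, hU, hxU, _, hslice _ hyx, (hjoin _ hxU x y hyx).unique hv (hj x hx y hys),
      fun p' hp' => hjoin p' hp' x y hyx⟩, ⟨U, hU, hyU, _, hslice _ hxy,
      (hjoin _ hyU y x hxy).unique hv (hj y hys x hx), fun p' hp' => hjoin p' hp' y x hxy⟩⟩
  · rintro x y z - - - ⟨O, hO, hxO, ψ, hψ, hψx, hψj⟩ ⟨O', hO', hyO', χ, hχ, hχy, hχj⟩
    refine ⟨O ∩ ψ ⁻¹' O', hψ.continuousOn.isOpen_inter_preimage hO hO',
      ⟨hxO, by rw [mem_preimage, hψx]; exact hyO'⟩, χ ∘ ψ,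
      hχ.comp (hψ.mono inter_subset_left) (fun p hp => hp.2), by simp [hψx, hχy], ?_⟩
    exact fun p' hp' => (hψj p' hp'.1).trans hv (hχj _ hp'.2)

end Transport

/-- The entries of the inverse of an invertible matrix depend smoothly on the matrix. -/
theorem contMDiffAt_matrix_inv {E : Type*} [NormedAddCommGroup E] [NormedSpace ℝ E]
    {H : Type*} [TopologicalSpace H] {I : ModelWithCorners ℝ E H}
    {M : Type*} [TopologicalSpace M] [ChartedSpace H M] {ι : Type*} [Fintype ι] [DecidableEq ι]
    {A : M → Matrix ι ι ℝ} {p : M} (hA : ∀ i j, ContMDiffAt I 𝓘(ℝ) ∞ (fun x => A x i j) p)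
    (hdet : (A p).det ≠ 0) (i j : ι) : ContMDiffAt I 𝓘(ℝ) ∞ (fun x => (A x)⁻¹ i j) p := by
  have hd : ∀ B : M → Matrix ι ι ℝ, (∀ i j, ContMDiffAt I 𝓘(ℝ) ∞ (fun x => B x i j) p) →
      ContMDiffAt I 𝓘(ℝ) ∞ (fun x => (B x).det) p := by
    intro B hB
    simp only [Matrix.det_apply']
    refine contMDiffAt_finsetSum fun σ _ => contMDiffAt_const.mul ?_
    exact contMDiffAt_finsetProd fun k _ => hB _ _
  have hinv : ContMDiffAt I 𝓘(ℝ) ∞ (fun x => ((A x).det)⁻¹) p :=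
    ((contDiffAt_inv ℝ hdet).contMDiffAt).comp p (hd A hA)
  simp only [Matrix.inv_def, Ring.inverse_eq_inv', Matrix.smul_apply, smul_eq_mul,
    Matrix.adjugate_apply]
  refine hinv.mul (hd _ fun k l => ?_)
  by_cases hk : k = j
  · subst hk
    simp only [Matrix.updateRow_self]
    exact contMDiffAt_const
  · simp only [Matrix.updateRow_ne hk]
    exact hA k l

/-! ### Smooth fields, gradients and causality for a Lorentzian metric -/

section Metric

variable {V : Type*} [TopologicalSpace V] [ChartedSpace (EuclideanSpace ℝ (Fin 4)) V]
  [IsManifold (𝓡 4) ∞ V]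

/-- Smoothness of a vector field at a point. -/
def SmoothFieldAt (X : (p : V) → TangentSpace (𝓡 4) p) (p : V) : Prop :=
  ContMDiffAt (𝓡 4) (𝓡 4).tangent ∞ (fun x => (⟨x, X x⟩ : TangentBundle (𝓡 4) V)) p

theorem SmoothFieldAt.diff {f : V → ℝ} {X : (p : V) → TangentSpace (𝓡 4) p} {p : V}
    (hf : ContMDiffAt (𝓡 4) 𝓘(ℝ) ∞ f p) (hX : SmoothFieldAt X p) :
    ContMDiffAt (𝓡 4) 𝓘(ℝ) ∞ (fun x => diff f x (X x)) p := by
  have h1 := hf.mfderiv_const (m := ∞) (by simp)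
  have h2 : ContMDiffAt (𝓡 4) 𝓘(ℝ).tangent ∞
      (fun m => (⟨f m, mfderiv (𝓡 4) 𝓘(ℝ) f m (X m)⟩ : TangentBundle 𝓘(ℝ) ℝ)) p :=
    ContMDiffAt.clm_apply_of_inCoordinates (b₁ := id) h1 hX hf
  exact ((contMDiff_snd_tangentBundle_modelSpace ℝ 𝓘(ℝ)).contMDiffAt).comp p h2

namespace LorentzMetric

variable (g : LorentzMetric V)

theorem contMDiffAt_val {X Y : (p : V) → TangentSpace (𝓡 4) p} {p : V}
    (hX : SmoothFieldAt X p) (hY : SmoothFieldAt Y p) :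
    ContMDiffAt (𝓡 4) 𝓘(ℝ) ∞ (fun x => g.val x (X x) (Y x)) p := by
  have h := ContMDiffAt.clm_bundle_apply₂ (F₃ := ℝ) (E₃ := Bundle.Trivial V ℝ)
    (g.contMDiff p) hX hY
  rw [Bundle.contMDiffAt_section] at h
  exact h

/-- A vector field is smooth if its inner products with smooth vector fields are. -/
theorem smoothFieldAt_of_val {X : (p : V) → TangentSpace (𝓡 4) p} {p : V}
    (h : ∀ Y : (p : V) → TangentSpace (𝓡 4) p, SmoothFieldAt Y p →
      ContMDiffAt (𝓡 4) 𝓘(ℝ) ∞ (fun x => g.val x (X x) (Y x)) p) : SmoothFieldAt X p := by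
  set b := (EuclideanSpace.basisFun (Fin 4) ℝ).toBasis with hb
  set e := trivializationAt (EuclideanSpace ℝ (Fin 4)) (TangentSpace (𝓡 4) : V → Type _) p with he
  have hp : p ∈ e.baseSet := FiberBundle.mem_baseSet_trivializationAt' p
  set s := e.localFrame b with hs
  have hss : ∀ i, SmoothFieldAt (s i) p := fun i => contMDiffAt_localFrame_of_mem ∞ e b i hp
  -- Gram matrix of a local frame, invertible because the metric is nondegenerate. Its inverse
  -- recovers the frame components of X smoothly from the products g(X, s j).
  set G : V → Matrix (Fin 4) (Fin 4) ℝ := fun x => Matrix.of fun i j => g.val x (s j x) (s i x)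
    with hG
  have hdet : ∀ x ∈ e.baseSet, (G x).det ≠ 0 := by
    intro x hx h0
    obtain ⟨c, hc, hc0⟩ := Matrix.exists_mulVec_eq_zero_iff.2 h0
    apply hc
    have h1 : ∑ j, c j • s j x = 0 := by
      refine g.eq_zero_of_forall x _ fun w => ?_
      have hw : ∀ i, g.val x (∑ j, c j • s j x) (s i x) = 0 := by
        intro i
        have := congrFun hc0 i
        simp only [Matrix.mulVec, dotProduct, hG, Matrix.of_apply, Pi.zero_apply] at this
        rw [map_sum, sum_apply]
        refine Eq.trans (Finset.sum_congr rfl fun j _ => ?_) this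
        rw [map_smul, smul_apply, smul_eq_mul, mul_comm]
      rw [← (e.basisAt b hx).sum_repr w, map_sum]
      refine Finset.sum_eq_zero fun i _ => ?_
      rw [map_smul, ← e.localFrame_apply_of_mem_baseSet b hx, hw i, smul_zero]
    have h2 : ∑ j, c j • e.basisAt b hx j = 0 := by
      rw [← h1]
      exact Finset.sum_congr rfl fun j _ => by rw [hs, e.localFrame_apply_of_mem_baseSet b hx]
    funext j
    exact (Fintype.linearIndependent_iff.1 (e.basisAt b hx).linearIndependent) c h2 j
  have hGs : ∀ i j, ContMDiffAt (𝓡 4) 𝓘(ℝ) ∞ (fun x => G x i j) p := fun i j =>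
    g.contMDiffAt_val (hss j) (hss i)
  have hcoef : ∀ x ∈ e.baseSet, X x =
      ∑ i, (∑ j, (G x)⁻¹ i j * g.val x (X x) (s j x)) • s i x := by
    intro x hx
    set c := (e.basisAt b hx).repr (X x) with hc
    have hX : X x = ∑ i, c i • s i x := by
      rw [← (e.basisAt b hx).sum_repr (X x)]
      exact Finset.sum_congr rfl fun j _ => by rw [hs, e.localFrame_apply_of_mem_baseSet b hx]
    have h1 : (G x).mulVec c = fun j => g.val x (X x) (s j x) := by
      funext j
      rw [hX, map_sum, sum_apply]
      simp only [Matrix.mulVec, dotProduct, hG, Matrix.of_apply]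
      refine Finset.sum_congr rfl fun i _ => ?_
      rw [map_smul, smul_apply, smul_eq_mul, mul_comm]
    have h2 : (c : Fin 4 → ℝ) = (G x)⁻¹.mulVec (fun j => g.val x (X x) (s j x)) := by
      rw [← h1, Matrix.mulVec_mulVec, Matrix.nonsing_inv_mul _ (hdet x hx).isUnit,
        Matrix.one_mulVec]
    refine hX.trans (Finset.sum_congr rfl fun i _ => ?_)
    rw [congrFun h2 i]
    rfl
  have hsum : SmoothFieldAt (fun x => ∑ i, (∑ j, (G x)⁻¹ i j * g.val x (X x) (s j x)) • s i x) p :=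
    ContMDiffAt.sum_section fun i _ => ContMDiffAt.smul_section
      (contMDiffAt_finsetSum fun j _ =>
        (contMDiffAt_matrix_inv hGs (hdet p hp) i j).mul (h _ (hss j))) (hss i)
  refine hsum.congr_of_eventuallyEq ?_
  filter_upwards [e.open_baseSet.mem_nhds hp] with x hx
  rw [← hcoef x hx]

/-- The inner product of the gradient with a smooth field Y is the derivative of f along Y, which is
smooth. -/
theorem smoothFieldAt_grad {f : V → ℝ} {p : V} (hf : ContMDiffAt (𝓡 4) 𝓘(ℝ) ∞ f p) :
    SmoothFieldAt (g.grad f) p :=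
  g.smoothFieldAt_of_val fun Y hY => by
    simp only [g.val_grad]
    exact hY.diff hf

/-- A nonzero vector orthogonal to a timelike vector is spacelike. -/
theorem val_self_pos_of_orthogonal {p : V} {t z : TangentSpace (𝓡 4) p} (ht : g.val p t t < 0)
    (hz : g.val p t z = 0) (hz0 : z ≠ 0) : 0 < g.val p z z := by
  obtain ⟨b, hb⟩ := g.exists_frame p
  have hform : ∀ v w, g.val p v w = -(b.repr v 0 * b.repr w 0) + b.repr v 1 * b.repr w 1 +
      b.repr v 2 * b.repr w 2 + b.repr v 3 * b.repr w 3 := by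
    intro v w
    conv_lhs => rw [← b.sum_repr v, ← b.sum_repr w]
    simp only [Fin.sum_univ_four, map_add, map_smul, add_apply, smul_apply, smul_eq_mul]
    simp only [hb, minkowskiSign, Fin.reduceEq, if_true, if_false]
    ring
  rw [hform] at ht hz ⊢
  have hne : ∃ i, b.repr z i ≠ 0 := by
    by_contra! hcon
    exact hz0 (b.ext_elem_iff.2 fun i => by simpa using hcon i)
  generalize b.repr t = T at *
  generalize b.repr z = Z at *
  -- Cauchy–Schwarz for the spatial parts; orthogonality makes the left side (T 0 * Z 0)², and T
  -- being timelike then forces the time part of Z to be shorter than its spatial part.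
  have hCS : (T 1 * Z 1 + T 2 * Z 2 + T 3 * Z 3) ^ 2 ≤
      (T 1 ^ 2 + T 2 ^ 2 + T 3 ^ 2) * (Z 1 ^ 2 + Z 2 ^ 2 + Z 3 ^ 2) := by
    nlinarith [sq_nonneg (T 1 * Z 2 - T 2 * Z 1), sq_nonneg (T 1 * Z 3 - T 3 * Z 1),
      sq_nonneg (T 2 * Z 3 - T 3 * Z 2)]
  have h1 : T 1 * Z 1 + T 2 * Z 2 + T 3 * Z 3 = T 0 * Z 0 := by linarith
  rw [h1] at hCS
  have hT : T 1 ^ 2 + T 2 ^ 2 + T 3 ^ 2 < T 0 ^ 2 := by nlinarith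
  have hT0 : 0 < T 0 ^ 2 := lt_of_le_of_lt (by positivity) hT
  rcases (show 0 ≤ Z 1 ^ 2 + Z 2 ^ 2 + Z 3 ^ 2 by positivity).eq_or_lt with h0 | hpos
  · exfalso
    rw [← h0, mul_zero] at hCS
    have hZ0 : Z 0 = 0 := by
      have h3 : T 0 * Z 0 = 0 := pow_eq_zero_iff (two_ne_zero) |>.1 (le_antisymm hCS (sq_nonneg _))
      rcases mul_eq_zero.1 h3 with h4 | h4
      · rw [h4] at hT0; norm_num at hT0
      · exact h4
    obtain ⟨i, hi⟩ := hne
    have h5 : Z 1 = 0 ∧ Z 2 = 0 ∧ Z 3 = 0 := by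
      refine ⟨?_, ?_, ?_⟩ <;> nlinarith [sq_nonneg (Z 1), sq_nonneg (Z 2), sq_nonneg (Z 3)]
    fin_cases i
    · exact hi hZ0
    · exact hi h5.1
    · exact hi h5.2.1
    · exact hi h5.2.2
  · have h2 : T 0 ^ 2 * Z 0 ^ 2 < T 0 ^ 2 * (Z 1 ^ 2 + Z 2 ^ 2 + Z 3 ^ 2) := by
      nlinarith [mul_lt_mul_of_pos_right hT hpos]
    have h3 := lt_of_mul_lt_mul_left h2 hT0.le
    nlinarith

end LorentzMetric

end Metric

/-! ### The null frame and the form of the metric -/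

namespace LorentzMetric

variable {V : Type*} [TopologicalSpace V] [ChartedSpace (EuclideanSpace ℝ (Fin 4)) V]
  [IsManifold (𝓡 4) ∞ V] (g : LorentzMetric V) {u ub : V → ℝ}

theorem val_nullGen (f : V → ℝ) (p : V) (w : TangentSpace (𝓡 4) p) :
    g.val p (g.nullGen f p) w = -diff f p w := by
  rw [nullGen, map_neg, neg_apply, val_grad]

theorem val_nullGen_nullGen (f h : V → ℝ) (p : V) :
    g.val p (g.nullGen f p) (g.nullGen h p) = g.val p (g.grad f p) (g.grad h p) := by
  rw [nullGen, nullGen, map_neg, map_neg, neg_apply, neg_neg]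

theorem diff_nullGen (f h : V → ℝ) (p : V) :
    diff f p (g.nullGen h p) = -g.val p (g.nullGen f p) (g.nullGen h p) := by
  rw [val_nullGen, neg_neg]

theorem val_incoming (u ub : V → ℝ) (p : V) (z : TangentSpace (𝓡 4) p) :
    g.val p (g.incoming u ub p) z = -(2 * g.lapse u ub p ^ 2) * diff ub p z := by
  rw [incoming, map_smul, smul_apply, val_nullGen, smul_eq_mul, mul_neg, neg_mul]

theorem val_outgoing (u ub : V → ℝ) (p : V) (z : TangentSpace (𝓡 4) p) :
    g.val p (g.outgoing u ub p) z = -(2 * g.lapse u ub p ^ 2) * diff u p z := by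
  rw [outgoing, map_smul, smul_apply, val_nullGen, smul_eq_mul, mul_neg, neg_mul]

theorem smoothFieldAt_nullGen {f : V → ℝ} (hf : ContMDiff (𝓡 4) 𝓘(ℝ) ∞ f) (p : V) :
    SmoothFieldAt (g.nullGen f) p :=
  ContMDiffAt.neg_section (g.smoothFieldAt_grad (hf p))

variable {g}

namespace IsDoubleNullFoliation

theorem lapse_sq (hfol : g.IsDoubleNullFoliation u ub) (p : V) :
    2 * g.lapse u ub p ^ 2 = -(g.val p (g.nullGen u p) (g.nullGen ub p))⁻¹ := by
  have hk := hfol.val_neg p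
  rw [lapse, Real.sq_sqrt (div_nonneg_of_nonpos (by norm_num) (by linarith))]
  field_simp

theorem lapse_pos (hfol : g.IsDoubleNullFoliation u ub) (p : V) : 0 < g.lapse u ub p := by
  have hk := hfol.val_neg p
  exact Real.sqrt_pos.2 (div_pos_of_neg_of_neg (by norm_num) (by linarith))

theorem val_eq_lapse (hfol : g.IsDoubleNullFoliation u ub) (p : V) :
    g.val p (g.nullGen u p) (g.nullGen ub p) = -(2 * g.lapse u ub p ^ 2)⁻¹ := by
  rw [hfol.lapse_sq, inv_neg, inv_inv, neg_neg]

/-- The factor 2Ω² in N̲ is exactly the reciprocal of -g(L, L̲), which is the derivative of u along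
L̲. -/
theorem diff_u_incoming (hfol : g.IsDoubleNullFoliation u ub) (p : V) : diff u p (g.incoming u ub p) = 1 := by
  rw [incoming, map_smul, diff_nullGen, smul_eq_mul, hfol.lapse_sq, neg_mul_neg,
    inv_mul_cancel₀ (hfol.val_neg p).ne]

theorem diff_ub_incoming (hfol : g.IsDoubleNullFoliation u ub) (p : V) : diff ub p (g.incoming u ub p) = 0 := by
  rw [incoming, map_smul, diff_nullGen, val_nullGen_nullGen, hfol.eikonal_ub, neg_zero, smul_zero]

theorem diff_u_outgoing (hfol : g.IsDoubleNullFoliation u ub) (p : V) : diff u p (g.outgoing u ub p) = 0 := by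
  rw [outgoing, map_smul, diff_nullGen, val_nullGen_nullGen, hfol.eikonal_u, neg_zero, smul_zero]

theorem diff_ub_outgoing (hfol : g.IsDoubleNullFoliation u ub) (p : V) : diff ub p (g.outgoing u ub p) = 1 := by
  rw [outgoing, map_smul, diff_nullGen, g.symm, smul_eq_mul, hfol.lapse_sq, neg_mul_neg,
    inv_mul_cancel₀ (hfol.val_neg p).ne]

theorem incoming_ne_zero (hfol : g.IsDoubleNullFoliation u ub) (p : V) : g.incoming u ub p ≠ 0 := fun h => by
  have := hfol.diff_u_incoming p
  rw [h, map_zero] at this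
  exact zero_ne_one this

theorem contMDiffAt_lapse_sq (hfol : g.IsDoubleNullFoliation u ub) (p : V) :
    ContMDiffAt (𝓡 4) 𝓘(ℝ) ∞ (fun x => 2 * g.lapse u ub x ^ 2) p := by
  simp only [hfol.lapse_sq]
  have h := g.contMDiffAt_val (g.smoothFieldAt_nullGen hfol.contMDiff_u p)
    (g.smoothFieldAt_nullGen hfol.contMDiff_ub p)
  have hinv := ((contDiffAt_inv (n := ∞) ℝ (hfol.val_neg p).ne).neg).contMDiffAt
  exact ContMDiffAt.comp (g := fun y : ℝ => -y⁻¹) p hinv h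

theorem smoothFieldAt_incoming (hfol : g.IsDoubleNullFoliation u ub) (p : V) : SmoothFieldAt (g.incoming u ub) p :=
  ContMDiffAt.smul_section (hfol.contMDiffAt_lapse_sq p)
    (g.smoothFieldAt_nullGen hfol.contMDiff_ub p)

theorem smoothFieldAt_outgoing (hfol : g.IsDoubleNullFoliation u ub) (p : V) : SmoothFieldAt (g.outgoing u ub) p :=
  ContMDiffAt.smul_section (hfol.contMDiffAt_lapse_sq p)
    (g.smoothFieldAt_nullGen hfol.contMDiff_u p)

/-- The tangent vectors of the surfaces `u = const`, `u̲ = const` are spacelike. -/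
theorem val_self_pos (hfol : g.IsDoubleNullFoliation u ub) {p : V} {z : TangentSpace (𝓡 4) p} (hu : diff u p z = 0)
    (hub : diff ub p z = 0) (hz : z ≠ 0) : 0 < g.val p z z := by
  -- L + L̲ is timelike, since L and L̲ are null and g(L, L̲) < 0; vectors annihilated by du and du̲
  -- are orthogonal to it.
  refine g.val_self_pos_of_orthogonal (t := g.nullGen u p + g.nullGen ub p) ?_ ?_ hz
  · have h1 : g.val p (g.nullGen u p) (g.nullGen u p) = 0 := by
      rw [val_nullGen_nullGen, hfol.eikonal_u]
    have h2 : g.val p (g.nullGen ub p) (g.nullGen ub p) = 0 := by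
      rw [val_nullGen_nullGen, hfol.eikonal_ub]
    have h3 := hfol.val_neg p
    have h4 := g.symm p (g.nullGen ub p) (g.nullGen u p)
    rw [map_add, map_add, add_apply, add_apply, h1, h2, h4]
    linarith
  · rw [map_add, add_apply, val_nullGen, val_nullGen, hu, hub]
    norm_num

/-- The metric in coordinates `(u, u̲, ω¹, ω²)`, where `∂ a` are the coordinate vectors of the
angular coordinates and `α a` the angular differentials. -/
theorem metric_decomposition (hfol : g.IsDoubleNullFoliation u ub) {p : V}
    (α : Fin 2 → TangentSpace (𝓡 4) p →L[ℝ] ℝ)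
    (X : Fin 2 → TangentSpace (𝓡 4) p)
    (hu : ∀ i, diff u p (X i) = 0) (hub : ∀ i, diff ub p (X i) = 0)
    (hα : ∀ i j, α i (X j) = if i = j then 1 else 0)
    (hinj : ∀ z, diff u p z = 0 → diff ub p z = 0 → (∀ i, α i z = 0) → z = 0) :
    (Matrix.of fun i j => g.val p (X i) (X j)).PosDef ∧
    ∀ v w : TangentSpace (𝓡 4) p, g.val p v w =
      -2 * g.lapse u ub p ^ 2 * (diff u p v * diff ub p w + diff ub p v * diff u p w) +
      ∑ i, ∑ j, g.val p (X i) (X j) *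
        (α i v - (α i (g.incoming u ub p) * diff u p v + α i (g.outgoing u ub p) * diff ub p v)) *
        (α j w - (α j (g.incoming u ub p) * diff u p w +
          α j (g.outgoing u ub p) * diff ub p w)) := by
  refine ⟨Matrix.PosDef.of_dotProduct_mulVec_pos ?_ ?_, ?_⟩
  · ext i j
    simp [Matrix.conjTranspose_apply, g.symm p (X i) (X j)]
  · intro c hc
    have hne : c 0 • X 0 + c 1 • X 1 ≠ 0 := by
      intro h0
      apply hc
      have h1 := fun i => congrArg (α i) h0
      simp only [map_add, map_smul, smul_eq_mul, hα, map_zero] at h1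
      funext i
      fin_cases i
      · simpa using h1 0
      · simpa using h1 1
    have hpos := hfol.val_self_pos (by simp [hu]) (by simp [hub]) hne
    simp only [map_add, map_smul, add_apply, smul_apply, smul_eq_mul] at hpos
    simp only [dotProduct, Matrix.mulVec, Matrix.of_apply, Fin.sum_univ_two, Pi.star_apply,
      star_trivial]
    linarith
  · intro v w
    -- Expansion of z in the frame N̲, N, X 0, X 1: the two sides have equal values of du, du̲ and
    -- each α i, and these four forms separate vectors. The products h1 to h4 then leave only g(N,
    -- N̲) = -2Ω² and the angular block.
    have hdec : ∀ z, z = diff u p z • g.incoming u ub p + diff ub p z • g.outgoing u ub p +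
        ∑ i, (α i z - (α i (g.incoming u ub p) * diff u p z +
          α i (g.outgoing u ub p) * diff ub p z)) • X i := by
      intro z
      rw [← sub_eq_zero]
      apply hinj
      · simp only [map_sub, map_add, map_smul, map_sum, hfol.diff_u_incoming,
          hfol.diff_u_outgoing, hu, smul_eq_mul]
        simp
      · simp only [map_sub, map_add, map_smul, map_sum, hfol.diff_ub_incoming,
          hfol.diff_ub_outgoing, hub, smul_eq_mul]
        simp
      · intro i
        simp only [map_sub, map_add, map_smul, map_sum, hα, smul_eq_mul]
        simp
        ring
    have h1 : ∀ z, g.val p (g.incoming u ub p) z = _ := g.val_incoming u ub p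
    have h2 : ∀ z, g.val p (g.outgoing u ub p) z = _ := g.val_outgoing u ub p
    have h3 : ∀ i, g.val p (X i) (g.incoming u ub p) = 0 := fun i => by
      rw [g.symm, h1, hub, mul_zero]
    have h4 : ∀ i, g.val p (X i) (g.outgoing u ub p) = 0 := fun i => by
      rw [g.symm, h2, hu, mul_zero]
    generalize hv : (fun i => α i v - (α i (g.incoming u ub p) * diff u p v +
      α i (g.outgoing u ub p) * diff ub p v)) = ηv
    generalize hw : (fun i => α i w - (α i (g.incoming u ub p) * diff u p w +
      α i (g.outgoing u ub p) * diff ub p w)) = ηw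
    have hv' := fun i => congrFun hv i
    have hw' := fun i => congrFun hw i
    beta_reduce at hv' hw'
    have hdv := hdec v
    have hdw := hdec w
    simp only [hv', hw'] at hdv hdw ⊢
    conv_lhs => rw [hdv, hdw]
    simp only [map_add, map_smul, add_apply, smul_apply, smul_eq_mul, Fin.sum_univ_two, h1, h2, h3,
      h4, hfol.diff_u_incoming, hfol.diff_ub_incoming, hfol.diff_u_outgoing, hfol.diff_ub_outgoing,
      hu, hub]
    ring

end IsDoubleNullFoliation
end LorentzMetric

/-- An injective linear map between spaces of equal finite dimension, as a continuous linear
equivalence. -/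
theorem exists_continuousLinearEquiv_of_injective {E F : Type*}
    [NormedAddCommGroup E] [NormedSpace ℝ E] [FiniteDimensional ℝ E]
    [NormedAddCommGroup F] [NormedSpace ℝ F] [FiniteDimensional ℝ F]
    (hdim : Module.finrank ℝ E = Module.finrank ℝ F) (L : E →L[ℝ] F)
    (hL : ∀ x, L x = 0 → x = 0) : ∃ L' : E ≃L[ℝ] F, (L' : E →L[ℝ] F) = L := by
  have hinj : Function.Injective (L : E →ₗ[ℝ] F) := by
    rw [← LinearMap.ker_eq_bot, LinearMap.ker_eq_bot']
    exact hL
  refine ⟨(LinearMap.linearEquivOfInjective (L : E →ₗ[ℝ] F) hinj hdim).toContinuousLinearEquiv, ?_⟩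
  ext x
  rfl

/-- A function with constant derivative along a vector field grows linearly along the integral
curves. -/
theorem Joined.apply_sub {V : Type*} [TopologicalSpace V]
    [ChartedSpace (EuclideanSpace ℝ (Fin 4)) V]
    {v : (p : V) → TangentSpace (𝓡 4) p} {f : V → ℝ} {c : ℝ}
    (hf : MDifferentiable (𝓡 4) 𝓘(ℝ) f) (hc : ∀ p, diff f p (v p) = c) {a b : ℝ} {p q : V}
    (h : Joined v a b p q) : f q - f p = c * (b - a) := by
  obtain ⟨γ, hγ, rfl, rfl⟩ := h
  have hd : ∀ t ∈ uIcc a b, HasDerivWithinAt (fun t => f (γ t) - c * t) 0 (uIcc a b) t := by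
    intro t ht
    have h1 : HasMFDerivWithinAt 𝓘(ℝ) 𝓘(ℝ) (f ∘ γ) (uIcc a b) t _ :=
      (hf (γ t)).hasMFDerivAt.comp_hasMFDerivWithinAt t (hγ t ht)
    have h3 : HasDerivWithinAt (f ∘ γ) c (uIcc a b) t := by
      rw [hasDerivWithinAt_iff_hasFDerivWithinAt]
      refine (hasMFDerivWithinAt_iff_hasFDerivWithinAt.1 h1).congr_fderiv ?_
      refine ContinuousLinearMap.ext_ring ?_
      have h4 : mfderiv (𝓡 4) 𝓘(ℝ) f (γ t) ((1 : ℝ) • v (γ t)) = (1 : ℝ) • c := by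
        rw [one_smul, one_smul]; exact hc _
      exact h4
    have h5 := h3.sub ((hasDerivWithinAt_id t (uIcc a b)).const_mul c)
    rw [mul_one, sub_self] at h5
    exact h5
  have h := (convex_uIcc a b).norm_image_sub_le_of_norm_hasDerivWithin_le (C := 0)
    hd (fun _ _ => by simp) left_mem_uIcc right_mem_uIcc
  rw [zero_mul, norm_le_zero_iff] at h
  linarith

/-! ### Patch coordinates along the incoming generators -/

namespace LorentzMetric

variable {V : Type*} [TopologicalSpace V] [ChartedSpace (EuclideanSpace ℝ (Fin 4)) V]
  [IsManifold (𝓡 4) ∞ V] {g : LorentzMetric V} {u ub : V → ℝ}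

namespace IsDoubleNullFoliation

theorem contMDiff_incoming (hfol : g.IsDoubleNullFoliation u ub) :
    ContMDiff (𝓡 4) (𝓡 4).tangent ∞
      (fun p => (⟨p, g.incoming u ub p⟩ : TangentBundle (𝓡 4) V)) :=
  fun p => hfol.smoothFieldAt_incoming p

theorem u_sub_of_joined (hfol : g.IsDoubleNullFoliation u ub) {a b : ℝ} {p q : V}
    (h : Joined (g.incoming u ub) a b p q) : u q - u p = b - a := by
  rw [h.apply_sub (hfol.contMDiff_u.mdifferentiable (by simp)) hfol.diff_u_incoming, one_mul]

theorem ub_eq_of_joined (hfol : g.IsDoubleNullFoliation u ub) {a b : ℝ} {p q : V}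
    (h : Joined (g.incoming u ub) a b p q) : ub q = ub p := by
  have := h.apply_sub (hfol.contMDiff_ub.mdifferentiable (by simp)) hfol.diff_ub_incoming
  linarith

/-- Since u grows at unit rate along N̲, the parameter differs from u by a constant, and a shift of
the parameter turns it into u. -/
theorem onIncomingGenerator_of_joined (hfol : g.IsDoubleNullFoliation u ub) {a b : ℝ} {p q : V}
    (h : Joined (g.incoming u ub) a b p q) : g.OnIncomingGenerator u ub p q := by
  have h1 := hfol.u_sub_of_joined h
  have h2 := h.shift (u p - a)
  rw [add_sub_cancel, show b + (u p - a) = u q by linarith] at h2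
  exact h2

/-- A point lies on the generator through at most one point of the initial patch. -/
theorem eq_of_onIncomingGenerator [T2Space V] (hfol : g.IsDoubleNullFoliation u ub)
    {A : Set (ℝ × ℝ × ℝ)} {ι : ℝ × ℝ × ℝ → V} (hι : g.IsInitialPatch u ub A ι)
    {w w' : ℝ × ℝ × ℝ} (hw : w ∈ A) (hw' : w' ∈ A) {p : V}
    (h : g.OnIncomingGenerator u ub (ι w) p) (h' : g.OnIncomingGenerator u ub (ι w') p) :
    w = w' := by
  have key : ∀ w ∈ A, ∀ w' ∈ A, u (ι w) ≤ u (ι w') →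
      Joined (g.incoming u ub) (u (ι w)) (u (ι w')) (ι w) (ι w') → w = w' := by
    intro w hw w' hw' hle hj
    obtain ⟨γ, hγ, h1, h2⟩ := id hj
    rw [uIcc_of_le hle] at hγ
    have he := hι.meets_once γ _ _ hle hγ (by rw [h1]; exact mem_image_of_mem ι hw)
      (by rw [h2]; exact mem_image_of_mem ι hw')
    rw [he] at hj
    exact hι.injOn hw hw' hj.eq_of_self
  -- Going from ι w to p and back to ι w' yields one generator through both patch points, which
  -- `meets_once` then forces to be trivial.
  have hj : Joined (g.incoming u ub) (u (ι w)) (u (ι w')) (ι w) (ι w') :=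
    Joined.trans hfol.contMDiff_incoming h (Joined.symm h')
  rcases le_total (u (ι w)) (u (ι w')) with hle | hle
  · exact key w hw w' hw' hle hj
  · exact (key w' hw' w hw hle hj.symm).symm

/-- Near the initial patch, the coordinates of the patch extend smoothly along the incoming
generators, and together with `u` they determine the point smoothly. -/
theorem exists_coordinates_near_patch (hfol : g.IsDoubleNullFoliation u ub)
    {A : Set (ℝ × ℝ × ℝ)} {ι : ℝ × ℝ × ℝ → V} (hι : g.IsInitialPatch u ub A ι)
    {w₀ : ℝ × ℝ × ℝ} (hw₀ : w₀ ∈ A) :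
    ∃ O : Set V, IsOpen O ∧ ι w₀ ∈ O ∧ ∃ W : V → ℝ × ℝ × ℝ,
      ContMDiffOn (𝓡 4) 𝓘(ℝ, ℝ × ℝ × ℝ) ∞ W O ∧ (∀ p ∈ O, W p ∈ A) ∧
      (∀ p ∈ O, g.OnIncomingGenerator u ub (ι (W p)) p) ∧
      ∃ R : (ℝ × ℝ × ℝ) × ℝ → V,
        ContMDiffAt 𝓘(ℝ, (ℝ × ℝ × ℝ) × ℝ) (𝓡 4) ∞ R (W (ι w₀), u (ι w₀)) ∧
        ∀ p ∈ O, R (W p, u p) = p := by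
  set N := g.incoming u ub with hN
  set q₀ := ι w₀ with hq₀
  obtain ⟨ε, hε, U, hU, hq₀U, Fl, hFl, hFl'⟩ :=
    exists_smooth_local_flow_manifold hfol.contMDiff_incoming q₀
  set φ := extChartAt (𝓡 4) q₀ with hφ
  have hφs : ContMDiffOn (𝓡 4) 𝓘(ℝ, EuclideanSpace ℝ (Fin 4)) ∞ φ φ.source := by
    rw [hφ, extChartAt_source]; exact contMDiffOn_extChartAt
  have hφo : IsOpen φ.source := isOpen_extChartAt_source q₀
  set Θ : (ℝ × ℝ × ℝ) × ℝ → V := fun z => Fl (ι z.1, z.2) with hΘ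
  have hA' : IsOpen (A ∩ ι ⁻¹' U) := hι.contMDiffOn.continuousOn.isOpen_inter_preimage hι.isOpen hU
  set D : Set ((ℝ × ℝ × ℝ) × ℝ) := (A ∩ ι ⁻¹' U) ×ˢ Ioo (-ε) ε with hD
  have hDo : IsOpen D := hA'.prod isOpen_Ioo
  have hΘs : ContMDiffOn 𝓘(ℝ, (ℝ × ℝ × ℝ) × ℝ) (𝓡 4) ∞ Θ D := by
    refine hFl.comp (ContMDiffOn.prodMk ?_ contDiff_snd.contMDiff.contMDiffOn) ?_
    · exact hι.contMDiffOn.comp contDiff_fst.contMDiff.contMDiffOn (fun z hz => hz.1.1)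
    · exact fun z hz => ⟨hz.1.2, hz.2⟩
  set D' := D ∩ Θ ⁻¹' φ.source with hD'
  have hD'o : IsOpen D' := hΘs.continuousOn.isOpen_inter_preimage hDo hφo
  have h0 : (0 : ℝ) ∈ Ioo (-ε) ε := ⟨neg_lt_zero.2 hε, hε⟩
  have hz₀D : (w₀, (0 : ℝ)) ∈ D := ⟨⟨hw₀, hq₀U⟩, h0⟩
  have hΘ0 : Θ (w₀, 0) = q₀ := (hFl' q₀ hq₀U).1
  have hz₀ : (w₀, (0 : ℝ)) ∈ D' := ⟨hz₀D, by
    rw [mem_preimage, hΘ0]; exact mem_extChartAt_source q₀⟩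
  set F : (ℝ × ℝ × ℝ) × ℝ → EuclideanSpace ℝ (Fin 4) := fun z => φ (Θ z) with hF
  have hFs : ContDiffOn ℝ ∞ F D' := by
    rw [← contMDiffOn_iff_contDiffOn]
    exact hφs.comp (hΘs.mono inter_subset_left) (fun z hz => hz.2)
  have hFd : DifferentiableAt ℝ F (w₀, 0) :=
    (hFs.contDiffAt (hD'o.mem_nhds hz₀)).differentiableAt (by simp)
  have hφd : ∀ p ∈ φ.source, MDifferentiableAt (𝓡 4) 𝓘(ℝ, EuclideanSpace ℝ (Fin 4)) φ p :=
    fun p hp => (hφs.contMDiffAt (hφo.mem_nhds hp)).mdifferentiableAt (by simp)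
  have hιd : MDifferentiableAt 𝓘(ℝ, ℝ × ℝ × ℝ) (𝓡 4) ι w₀ :=
    (hι.contMDiffOn.contMDiffAt (hι.isOpen.mem_nhds hw₀)).mdifferentiableAt (by simp)
  have hd1 : ∀ ξ : ℝ × ℝ × ℝ, fderiv ℝ F (w₀, 0) (ξ, 0) =
      mfderiv (𝓡 4) 𝓘(ℝ, EuclideanSpace ℝ (Fin 4)) φ q₀
        (mfderiv 𝓘(ℝ, ℝ × ℝ × ℝ) (𝓡 4) ι w₀ ξ) := by
    intro ξ
    have e1 : HasFDerivAt (fun w => F (w, 0)) ((fderiv ℝ F (w₀, 0)).comp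
        (ContinuousLinearMap.inl ℝ (ℝ × ℝ × ℝ) ℝ)) w₀ :=
      HasFDerivAt.comp (g := F) w₀ hFd.hasFDerivAt (hasFDerivAt_prodMk_left w₀ (0 : ℝ))
    have e2 := (hφd q₀ (mem_extChartAt_source q₀)).hasMFDerivAt.comp w₀ hιd.hasMFDerivAt
    have e3 := hasMFDerivAt_iff_hasFDerivAt.1 e2
    have e4 : (fun w => F (w, 0)) =ᶠ[𝓝 w₀] φ ∘ ι := by
      filter_upwards [hA'.mem_nhds ⟨hw₀, hq₀U⟩] with w hw
      exact congrArg φ (hFl' _ hw.2).1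
    exact DFunLike.congr_fun ((e1.congr_of_eventuallyEq e4.symm).unique e3) ξ
  have hd2 : ∀ τ : ℝ, fderiv ℝ F (w₀, 0) (0, τ) =
      τ • mfderiv (𝓡 4) 𝓘(ℝ, EuclideanSpace ℝ (Fin 4)) φ q₀ (N q₀) := by
    intro τ
    have e1 : HasFDerivAt (fun t => F (w₀, t)) ((fderiv ℝ F (w₀, 0)).comp
        (ContinuousLinearMap.inr ℝ (ℝ × ℝ × ℝ) ℝ)) 0 :=
      HasFDerivAt.comp (g := F) (0 : ℝ) hFd.hasFDerivAt (hasFDerivAt_prodMk_right w₀ (0 : ℝ))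
    have e2 := (hφd (Fl (q₀, 0)) hz₀.2).hasMFDerivAt.comp (0 : ℝ)
      (((hFl' q₀ hq₀U).2 0 h0).hasMFDerivAt (Ioo_mem_nhds h0.1 h0.2))
    have e3 := (hasMFDerivAt_iff_hasFDerivAt.1 e2)
    have e4 := DFunLike.congr_fun (e1.unique e3) τ
    have e5 : mfderiv (𝓡 4) 𝓘(ℝ, EuclideanSpace ℝ (Fin 4)) φ (Fl (q₀, 0)) (τ • N (Fl (q₀, 0))) =
        τ • mfderiv (𝓡 4) 𝓘(ℝ, EuclideanSpace ℝ (Fin 4)) φ q₀ (N q₀) := by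
      rw [(hFl' q₀ hq₀U).1, map_smul]
    exact e4.trans e5
  -- Transversality. A kernel vector (ξ, τ) satisfies dι(ξ) = -τ N̲; the left side is spacelike
  -- unless ξ = 0 and the right side is null, so ξ = 0, and then τ = 0 because N̲ ≠ 0.
  have hinj : ∀ z, fderiv ℝ F (w₀, 0) z = 0 → z = 0 := by
    rintro ⟨ξ, τ⟩ hz
    have hsplit : fderiv ℝ F (w₀, 0) (ξ, τ) =
        mfderiv (𝓡 4) 𝓘(ℝ, EuclideanSpace ℝ (Fin 4)) φ q₀
          (mfderiv 𝓘(ℝ, ℝ × ℝ × ℝ) (𝓡 4) ι w₀ ξ + τ • N q₀) := by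
      rw [map_add, map_smul, ← hd1]
      refine Eq.trans ?_ (congrArg (fderiv ℝ F (w₀, 0) (ξ, 0) + ·) (hd2 τ))
      refine Eq.trans ?_ (map_add (fderiv ℝ F (w₀, 0)) (ξ, 0) (0, τ))
      simp
    obtain ⟨L, hL⟩ := isInvertible_mfderiv_extChartAt (I := 𝓡 4) (mem_extChartAt_source q₀)
    have hzero : mfderiv 𝓘(ℝ, ℝ × ℝ × ℝ) (𝓡 4) ι w₀ ξ + τ • N q₀ = 0 := by
      rw [hz] at hsplit
      have hL' : L (mfderiv 𝓘(ℝ, ℝ × ℝ × ℝ) (𝓡 4) ι w₀ ξ + τ • N q₀) = 0 :=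
        (DFunLike.congr_fun hL _).trans hsplit.symm
      exact (map_eq_zero_iff L L.injective).1 hL'
    have hξ : ξ = 0 := by
      by_contra hξ
      have hpos := hι.spacelike w₀ hw₀ ξ hξ
      rw [eq_neg_of_add_eq_zero_left hzero] at hpos
      rw [map_neg, map_neg, neg_apply, neg_neg, map_smul, map_smul, smul_apply,
        val_incoming, hfol.diff_ub_incoming] at hpos
      simp at hpos
    have hτ : τ = 0 := by
      rw [hξ] at hzero
      have h1 : τ • N q₀ = 0 := by
        rw [← hzero]
        exact (zero_add _).symm.trans (congrArg (· + τ • N q₀)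
          (map_zero (mfderiv 𝓘(ℝ, ℝ × ℝ × ℝ) (𝓡 4) ι w₀)).symm)
      exact (smul_eq_zero.1 h1).resolve_right (hfol.incoming_ne_zero q₀)
    rw [hξ, hτ]; rfl
  obtain ⟨L, hL⟩ := exists_continuousLinearEquiv_of_injective (by simp) _ hinj
  obtain ⟨e, hze, heD, heF, hes⟩ := exists_openPartialHomeomorph_contDiffOn_symm hD'o hFs hz₀ L
    (hL ▸ hFd.hasFDerivAt)
  set O : Set V := φ.source ∩ φ ⁻¹' e.target with hO
  set K : V → (ℝ × ℝ × ℝ) × ℝ := fun p => e.symm (φ p) with hK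
  have hKs : ContMDiffOn (𝓡 4) 𝓘(ℝ, (ℝ × ℝ × ℝ) × ℝ) ∞ K O :=
    (contMDiffOn_iff_contDiffOn.2 hes).comp (hφs.mono inter_subset_left) (fun p hp => hp.2)
  have hKD : ∀ p ∈ O, K p ∈ D' := fun p hp => heD (e.map_target hp.2)
  have hΘK : ∀ p ∈ O, Θ (K p) = p := by
    intro p hp
    refine φ.injOn (hKD p hp).2 hp.1 ?_
    change F (K p) = φ p
    rw [← heF]
    exact e.right_inv hp.2
  have hjoin : ∀ p ∈ O, Joined N 0 (K p).2 (ι (K p).1) p := by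
    intro p hp
    obtain ⟨h1, h2⟩ := hFl' _ (hKD p hp).1.1.2
    have h3 : Joined N 0 (K p).2 (Fl (ι (K p).1, 0)) (Fl (ι (K p).1, (K p).2)) :=
      joined_of_mem h2 (OrdConnected.uIcc_subset ordConnected_Ioo h0 (hKD p hp).1.2)
    rw [h1] at h3
    have h4 := hΘK p hp
    simp only [hΘ] at h4
    rwa [h4] at h3
  have hq₀O : q₀ ∈ O := by
    refine ⟨mem_extChartAt_source q₀, ?_⟩
    have : φ q₀ = e (w₀, 0) := by rw [heF, hF]; simp only; rw [hΘ0]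
    rw [mem_preimage, this]
    exact e.map_source hze
  have hK2 : ∀ p ∈ O, (K p).2 = u p - u (ι (K p).1) := fun p hp => by
    rw [hfol.u_sub_of_joined (hjoin p hp), sub_zero]
  -- The flow time from ι w to p is u p - u (ι w), so `R` recovers p from w and u by flowing ι w for
  -- that time.
  refine ⟨O, hφs.continuousOn.isOpen_inter_preimage hφo e.open_target, hq₀O, fun p => (K p).1,
    contDiff_fst.contMDiff.comp_contMDiffOn hKs, fun p hp => (hKD p hp).1.1.1,
    fun p hp => hfol.onIncomingGenerator_of_joined (hjoin p hp),
    fun z => Θ (z.1, z.2 - u (ι z.1)), ?_, fun p hp => ?_⟩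
  · have hKq := (hKD q₀ hq₀O).1
    have h1 : ContMDiffAt 𝓘(ℝ, (ℝ × ℝ × ℝ) × ℝ) (𝓡 4) ∞ Θ (K q₀) :=
      hΘs.contMDiffAt (hDo.mem_nhds hKq)
    have h2 : ContMDiffAt 𝓘(ℝ, (ℝ × ℝ × ℝ) × ℝ) 𝓘(ℝ) ∞
        (fun z : (ℝ × ℝ × ℝ) × ℝ => u (ι z.1)) ((K q₀).1, u q₀) :=
      hfol.contMDiff_u.contMDiffAt.comp _ (ContMDiffAt.comp (g := ι)
        ((K q₀).1, u q₀) (hι.contMDiffOn.contMDiffAt (hι.isOpen.mem_nhds hKq.1.1))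
        contDiff_fst.contMDiff.contMDiffAt)
    have h3 : ContMDiffAt 𝓘(ℝ, (ℝ × ℝ × ℝ) × ℝ) 𝓘(ℝ, (ℝ × ℝ × ℝ) × ℝ) ∞
        (fun z : (ℝ × ℝ × ℝ) × ℝ => (z.1, z.2 - u (ι z.1))) ((K q₀).1, u q₀) :=
      contDiff_fst.contMDiff.contMDiffAt.prodMk_space
        (contDiff_snd.contMDiff.contMDiffAt.sub h2)
    refine ContMDiffAt.comp (g := Θ) _ ?_ h3
    simp only
    rw [← hK2 q₀ hq₀O]
    exact h1
  · simp only
    rw [← hK2 p hp]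
    exact hΘK p hp

/-- The coordinates of the initial patch extend smoothly along the incoming generators, and
together with `u` they determine the point smoothly. -/
theorem exists_coordinates_near [T2Space V] (hfol : g.IsDoubleNullFoliation u ub)
    {A : Set (ℝ × ℝ × ℝ)} {ι : ℝ × ℝ × ℝ → V} (hι : g.IsInitialPatch u ub A ι)
    {w₀ : ℝ × ℝ × ℝ} (hw₀ : w₀ ∈ A) {p₀ : V} (hp₀ : g.OnIncomingGenerator u ub (ι w₀) p₀) :
    ∃ O : Set V, IsOpen O ∧ p₀ ∈ O ∧ ∃ W : V → ℝ × ℝ × ℝ,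
      ContMDiffOn (𝓡 4) 𝓘(ℝ, ℝ × ℝ × ℝ) ∞ W O ∧ (∀ p ∈ O, W p ∈ A) ∧
      (∀ p ∈ O, g.OnIncomingGenerator u ub (ι (W p)) p) ∧
      ∃ R : (ℝ × ℝ × ℝ) × ℝ → V,
        ContMDiffAt 𝓘(ℝ, (ℝ × ℝ × ℝ) × ℝ) (𝓡 4) ∞ R (W p₀, u p₀) ∧
        ∀ p ∈ O, R (W p, u p) = p := by
  have hj : Joined (g.incoming u ub) (u (ι w₀)) (u p₀) (ι w₀) p₀ := hp₀
  set q₀ := ι w₀ with hq₀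
  obtain ⟨O₁, hO₁, hqO₁, W, hW, hWA, hWg, R, hR, hRW⟩ := hfol.exists_coordinates_near_patch hι hw₀
  obtain ⟨O₂, hO₂, hpO₂, ψ, hψ, hψp, hψj⟩ := exists_smooth_transport hfol.contMDiff_incoming hj.symm
  obtain ⟨O₃, hO₃, hqO₃, χ, hχ, hχq, hχj⟩ := exists_smooth_transport hfol.contMDiff_incoming hj
  have huψ : ∀ p ∈ O₂, u (ψ p) = u p - u p₀ + u q₀ := fun p hp => by
    have := hfol.u_sub_of_joined (hψj p hp)
    linarith
  -- ψ carries a neighbourhood of p₀ back to the patch, where W and R are available, and χ carries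
  -- it forward again. Both act for the fixed time between p₀ and q₀, so u is only translated by a
  -- constant.
  refine ⟨O₂ ∩ ψ ⁻¹' (O₁ ∩ O₃), hψ.continuousOn.isOpen_inter_preimage hO₂ (hO₁.inter hO₃),
    ⟨hpO₂, by rw [mem_preimage, hψp]; exact ⟨hqO₁, hqO₃⟩⟩, W ∘ ψ,
    hW.comp (hψ.mono inter_subset_left) (fun p hp => hp.2.1), fun p hp => hWA _ hp.2.1,
    fun p hp => ?_, fun z => χ (R (z.1, z.2 - u p₀ + u q₀)), ?_, fun p hp => ?_⟩
  · refine hfol.onIncomingGenerator_of_joined (a := u (ι (W (ψ p)))) (b := u p) ?_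
    have h1 := ((hψj p hp.1).symm).shift (u p - u p₀)
    rw [add_sub_cancel, show u q₀ + (u p - u p₀) = u (ψ p) by rw [huψ p hp.1]; ring] at h1
    exact Joined.trans hfol.contMDiff_incoming (hWg _ hp.2.1) h1
  · have h1 : ContMDiffAt 𝓘(ℝ, (ℝ × ℝ × ℝ) × ℝ) 𝓘(ℝ, (ℝ × ℝ × ℝ) × ℝ) ∞
        (fun z : (ℝ × ℝ × ℝ) × ℝ => (z.1, z.2 - u p₀ + u q₀)) ((W ∘ ψ) p₀, u p₀) :=
      (contDiff_fst.prodMk ((contDiff_snd.sub contDiff_const).add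
        contDiff_const)).contMDiff.contMDiffAt
    have he : ((W ∘ ψ) p₀, u p₀ - u p₀ + u q₀) = (W q₀, u q₀) := by simp [hψp]
    have h2 := ContMDiffAt.comp (g := R) ((W ∘ ψ) p₀, u p₀) (by simp only; rw [he]; exact hR) h1
    refine ContMDiffAt.comp (g := χ) ((W ∘ ψ) p₀, u p₀) ?_ h2
    simp only [Function.comp] at he ⊢
    rw [he, hRW q₀ hqO₁]
    exact hχ.contMDiffAt (hO₃.mem_nhds hqO₃)
  · simp only [Function.comp]
    rw [← huψ p hp.1, hRW _ hp.2.1]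
    exact (hχj _ hp.2.2).unique hfol.contMDiff_incoming (hψj p hp.1).symm

end IsDoubleNullFoliation
end LorentzMetric

/-! ### The Kerr angular velocity and the azimuth shift -/

/-- The partial primitive of a smooth function of two variables is smooth. -/
theorem contDiffOn_intervalIntegral {W : ℝ × ℝ → ℝ} {s₀ s₁ : ℝ} {J : Set ℝ} (hJ : IsOpen J)
    (hW : ContDiffOn ℝ ∞ W (Ioi s₀ ×ˢ J)) (hs₁ : s₀ < s₁) :
    ContDiffOn ℝ ∞ (fun x : ℝ × ℝ => ∫ t in s₁..x.1, W (t, x.2)) (Ioi s₀ ×ˢ J) := by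
  rintro ⟨s, θ⟩ ⟨hs, hθ⟩
  have hs : s₀ < s := hs
  have hO : IsOpen (Ioi s₀ ×ˢ J) := isOpen_Ioi.prod hJ
  have hpath : ∀ τ ∈ Icc (0 : ℝ) 1, s₁ + (s - s₁) * τ ∈ uIcc s₁ s := by
    intro τ hτ
    rcases le_total s₁ s with h | h
    · rw [uIcc_of_le h]; constructor <;> nlinarith [hτ.1, hτ.2]
    · rw [uIcc_of_ge h]; constructor <;> nlinarith [hτ.1, hτ.2]
  obtain ⟨h, hh, hhW⟩ := exists_contDiff_eventuallyEq_nhdsSet hO hW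
    (isCompact_uIcc.prod isCompact_singleton : IsCompact (uIcc s₁ s ×ˢ {θ})) (by
      rintro ⟨t, θ'⟩ ⟨ht, rfl⟩
      exact ⟨lt_of_lt_of_le (lt_min hs₁ hs) ht.1, hθ⟩)
  -- After rescaling to τ in [0, 1], the integrand is evaluated on the path (s₁ + (x.1 - s₁) τ,
  -- x.2), which is affine in x as an element of C([-1, 1], ℝ × ℝ). The integral is thus a composite
  -- of smooth maps of Banach spaces.
  let β₀ : C(Icc (-1 : ℝ) 1, ℝ × ℝ) := ⟨fun τ => (s₁ - s₁ * τ, 0), by fun_prop⟩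
  let β₁ : C(Icc (-1 : ℝ) 1, ℝ × ℝ) := ⟨fun τ => (τ, 0), by fun_prop⟩
  let β₂ : C(Icc (-1 : ℝ) 1, ℝ × ℝ) := ⟨fun _ => (0, 1), by fun_prop⟩
  have hc : ContDiff ℝ ∞ (fun x : ℝ × ℝ => β₀ + x.1 • β₁ + x.2 • β₂) := by fun_prop
  have hsm : ContDiff ℝ ∞ (fun x : ℝ × ℝ => (x.1 - s₁) *
      primitive ℝ (postcomp h hh.continuous (β₀ + x.1 • β₁ + x.2 • β₂)) ⟨1, by norm_num⟩) :=
    (contDiff_fst.sub contDiff_const).mul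
      (((ContinuousMap.evalCLM ℝ (⟨1, by norm_num⟩ : Icc (-1 : ℝ) 1)).comp
        (primitive ℝ)).contDiff.comp ((contDiff_postcomp h hh).comp hc))
  refine (hsm.contDiffAt.congr_of_eventuallyEq ?_).contDiffWithinAt
  have hev : ∀ᶠ x in 𝓝 (s, θ), ∀ τ ∈ Icc (0 : ℝ) 1,
      h (s₁ + (x.1 - s₁) * τ, x.2) = W (s₁ + (x.1 - s₁) * τ, x.2) := by
    refine isCompact_Icc.eventually_forall_of_forall_eventually fun τ hτ => ?_
    have hcont : ContinuousAt (fun z : (ℝ × ℝ) × ℝ => (s₁ + (z.1.1 - s₁) * z.2, z.1.2))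
        ((s, θ), τ) := by fun_prop
    refine hcont.eventually (p := fun y => h y = W y) ?_
    exact eventually_nhdsSet_iff_forall.1 hhW _ ⟨hpath τ hτ, rfl⟩
  filter_upwards [hev] with x hx
  have h1 := intervalIntegral.smul_integral_comp_add_mul (a := (0 : ℝ)) (b := 1)
    (fun t => W (t, x.2)) (x.1 - s₁) s₁
  rw [mul_zero, mul_one, add_zero, add_sub_cancel] at h1
  rw [← h1, primitive_apply, smul_eq_mul]
  congr 1
  refine intervalIntegral.integral_congr fun τ hτ => ?_
  have hτ : τ ∈ Icc (0 : ℝ) 1 := by rwa [← uIcc_of_le zero_le_one]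
  have hτ' : τ ∈ Icc (-1 : ℝ) 1 := ⟨by linarith [hτ.1], hτ.2⟩
  rw [IccExtend_of_mem _ _ hτ', ← hx τ hτ, postcomp_apply]
  congr 1
  ext
  · simp [β₀, β₁, β₂]; ring
  · simp [β₀, β₁, β₂]

/-- The denominator Σ R² = (r² + a²)² - Δ a² sin² θ is positive: Δ ≤ r² + a² and sin² θ ≤ 1 bound
the subtracted term by (r² + a²) a², which is less than (r² + a²)² when r > 0. -/
theorem contDiffAt_kerrOmegaBL {M a : ℝ} (hM : 0 ≤ M) {x : ℝ × ℝ} (hx : 0 < x.1) :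
    ContDiffAt ℝ ∞ (fun x : ℝ × ℝ => kerrOmegaBL M a x.1 x.2) x := by
  have hS : kerrSigma a x.1 x.2 ≠ 0 := by
    unfold kerrSigma; positivity
  have hR : kerrSigma a x.1 x.2 * kerrRsq M a x.1 x.2 ≠ 0 := by
    unfold kerrRsq
    rw [mul_div_cancel₀ _ hS]
    have hD : kerrDelta M a x.1 ≤ x.1 ^ 2 + a ^ 2 := by
      unfold kerrDelta
      have := mul_nonneg hM hx.le
      linarith
    have h0 : 0 < x.1 ^ 2 + a ^ 2 := by positivity
    have h1 : kerrDelta M a x.1 * a ^ 2 * Real.sin x.2 ^ 2 ≤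
        (x.1 ^ 2 + a ^ 2) * a ^ 2 * Real.sin x.2 ^ 2 := by gcongr
    have h2 : (x.1 ^ 2 + a ^ 2) * a ^ 2 * Real.sin x.2 ^ 2 ≤ (x.1 ^ 2 + a ^ 2) * a ^ 2 :=
      mul_le_of_le_one_right (by positivity) (Real.sin_sq_le_one _)
    have h3 : (x.1 ^ 2 + a ^ 2) * a ^ 2 < (x.1 ^ 2 + a ^ 2) ^ 2 := by
      rw [sq (x.1 ^ 2 + a ^ 2)]
      exact mul_lt_mul_of_pos_left (by have := pow_pos hx 2; linarith) h0
    exact (sub_pos.2 (h1.trans_lt (h2.trans_lt h3))).ne'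
  have hsin : ContDiff ℝ ∞ (fun x : ℝ × ℝ => Real.sin x.2) := Real.contDiff_sin.comp contDiff_snd
  have hcos : ContDiff ℝ ∞ (fun x : ℝ × ℝ => Real.cos x.2) := Real.contDiff_cos.comp contDiff_snd
  have hSs : ContDiff ℝ ∞ (fun x : ℝ × ℝ => kerrSigma a x.1 x.2) := by
    unfold kerrSigma; fun_prop
  have hRs : ContDiffAt ℝ ∞ (fun x : ℝ × ℝ => kerrRsq M a x.1 x.2) x := by
    unfold kerrRsq kerrDelta
    exact ContDiffAt.div (by fun_prop) hSs.contDiffAt hS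
  unfold kerrOmegaBL
  exact ContDiffAt.div (by fun_prop) (hSs.contDiffAt.mul hRs) hR

namespace PretoriusIsraelChart

variable {M a s₀ : ℝ} (Φ : PretoriusIsraelChart M a s₀)

/-- `ω_B` as a function of the Pretorius–Israel coordinates. -/
def omegaStar (x : ℝ × ℝ) : ℝ := kerrOmegaBL M a (Φ.chart.symm x).1 (Φ.chart.symm x).2

theorem contDiffOn_omegaStar (hM : 0 ≤ M) :
    ContDiffOn ℝ ∞ Φ.omegaStar (Ioi s₀ ×ˢ Ioo 0 Real.pi) := by
  rw [← Φ.target_eq]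
  intro x hx
  have h1 := (Φ.source_subset (Φ.chart.map_target hx)).1
  have h2 : 0 < (Φ.chart.symm x).1 := lt_of_le_of_lt (by positivity) h1
  exact ContDiffAt.comp_contDiffWithinAt x (contDiffAt_kerrOmegaBL hM h2) (Φ.contDiffOn_symm x hx)

/-- The change of the azimuth: a primitive of `ω_B` in `u`. -/
def azimuthShift (l m θ : ℝ) : ℝ := -∫ t in (s₀ + 1)..(m - l), Φ.omegaStar (t, θ)

theorem contDiffOn_azimuthShift (hM : 0 ≤ M) :
    ContDiffOn ℝ ∞ (fun y : ℝ × ℝ × ℝ => Φ.azimuthShift y.1 y.2.1 y.2.2)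
      {y | s₀ < y.2.1 - y.1 ∧ y.2.2 ∈ Ioo 0 Real.pi} := by
  have h1 := (contDiffOn_intervalIntegral isOpen_Ioo (Φ.contDiffOn_omegaStar hM)
    (lt_add_one s₀)).neg
  exact h1.comp (t := Ioi s₀ ×ˢ Ioo 0 Real.pi) (g := fun x => -∫ t in (s₀ + 1)..x.1, Φ.omegaStar (t, x.2))
    (f := fun y : ℝ × ℝ × ℝ => (y.2.1 - y.1, y.2.2)) (by fun_prop) (fun y hy => ⟨hy.1, hy.2⟩)

/-- The variable l enters only through the upper limit m - l, whose derivative -1 cancels the sign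
in `azimuthShift`. The lower limit s₀ + 1 keeps the interval of integration inside the domain of
ω_B. -/
theorem hasDerivAt_azimuthShift (hM : 0 ≤ M) {l m θ : ℝ} (h : s₀ < m - l)
    (hθ : θ ∈ Ioo 0 Real.pi) :
    HasDerivAt (fun l' => Φ.azimuthShift l' m θ) (Φ.omegaB l m θ) l := by
  have hc : ContinuousOn (fun t => Φ.omegaStar (t, θ)) (Ioi s₀) :=
    (Φ.contDiffOn_omegaStar hM).continuousOn.comp (by fun_prop) (fun t ht => ⟨ht, hθ⟩)
  have hsub : uIcc (s₀ + 1) (m - l) ⊆ Ioi s₀ := fun t ht =>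
    lt_of_lt_of_le (lt_min (lt_add_one s₀) h) ht.1
  have h1 : HasDerivAt (fun s => ∫ t in (s₀ + 1)..s, Φ.omegaStar (t, θ))
      (Φ.omegaStar (m - l, θ)) (m - l) :=
    intervalIntegral.integral_hasDerivAt_right (hc.mono hsub).intervalIntegrable
      (hc.stronglyMeasurableAtFilter isOpen_Ioi _ h) (hc.continuousAt (Ioi_mem_nhds h))
  have h2 := (h1.comp l ((hasDerivAt_id l).const_sub m)).neg
  rw [mul_neg, mul_one, neg_neg] at h2
  exact h2

end PretoriusIsraelChart

/-! ### Charts from injective maps with smooth local left inverses -/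

section Charts

variable {V : Type*} [TopologicalSpace V] [ChartedSpace (EuclideanSpace ℝ (Fin 4)) V]
  [IsManifold (𝓡 4) ∞ V]

/-- A smooth map to the model space with a smooth local left inverse is open. -/
theorem map_nhds_eq_of_leftInverse {F : V → EuclideanSpace ℝ (Fin 4)} {p : V}
    (hF : ContMDiffAt (𝓡 4) 𝓘(ℝ, EuclideanSpace ℝ (Fin 4)) ∞ F p)
    {R : EuclideanSpace ℝ (Fin 4) → V}
    (hR : ContMDiffAt 𝓘(ℝ, EuclideanSpace ℝ (Fin 4)) (𝓡 4) ∞ R (F p))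
    (hRF : ∀ᶠ q in 𝓝 p, R (F q) = q) : map F (𝓝 p) = 𝓝 (F p) := by
  set φ := extChartAt (𝓡 4) p with hφ
  have hsymm : φ.symm (φ p) = p := extChartAt_to_inv p
  have hmap : map φ.symm (𝓝 (φ p)) = 𝓝 p := by
    have := map_extChartAt_symm_nhdsWithin_range (I := 𝓡 4) p
    rwa [ModelWithCorners.range_eq_univ, nhdsWithin_univ] at this
  have hφs : ContMDiffAt 𝓘(ℝ, EuclideanSpace ℝ (Fin 4)) (𝓡 4) ∞ φ.symm (φ p) :=
    (contMDiffOn_extChartAt_symm p).contMDiffAt (extChartAt_target_mem_nhds p)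
  have hG : ContDiffAt ℝ ∞ (F ∘ φ.symm) (φ p) :=
    contMDiffAt_iff_contDiffAt.1 (ContMDiffAt.comp (g := F) (φ p) (by rwa [hsymm]) hφs)
  have hRp : R (F p) = p := hRF.self_of_nhds
  have hH : ContDiffAt ℝ ∞ (φ ∘ R) ((F ∘ φ.symm) (φ p)) := by
    rw [Function.comp_apply, hsymm]
    refine contMDiffAt_iff_contDiffAt.1 (ContMDiffAt.comp (g := φ) (F p) ?_ hR)
    rw [hRp]
    exact contMDiffAt_extChartAt
  have hHG : (φ ∘ R) ∘ (F ∘ φ.symm) =ᶠ[𝓝 (φ p)] id := by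
    rw [← hmap, eventually_map] at hRF
    filter_upwards [hRF, extChartAt_target_mem_nhds (I := 𝓡 4) p] with x hx hxt
    simp only [Function.comp, hx, id]
    exact φ.right_inv hxt
  -- Differentiating the left inverse identity shows that the derivative of F in the chart is
  -- injective, hence an isomorphism by equality of dimensions; the inverse function theorem gives
  -- openness.
  have hd := ((hH.differentiableAt (by simp)).hasFDerivAt.comp (φ p)
    (hG.differentiableAt (by simp)).hasFDerivAt).unique
    ((hasFDerivAt_id (φ p)).congr_of_eventuallyEq hHG)
  obtain ⟨L, hL⟩ := exists_continuousLinearEquiv_of_injective rfl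
    (fderiv ℝ (F ∘ φ.symm) (φ p)) (fun x hx => by
      have := DFunLike.congr_fun hd x
      rw [ContinuousLinearMap.comp_apply, hx, map_zero] at this
      exact this.symm)
  have hstrict : HasStrictFDerivAt (F ∘ φ.symm) (L : _ →L[ℝ] _) (φ p) := by
    rw [hL]; exact hG.hasStrictFDerivAt (by simp)
  have := hstrict.map_nhds_eq_of_equiv
  rwa [← map_map, hmap, Function.comp_apply, hsymm] at this

/-- An injective smooth map to the model space with smooth local left inverses is a chart. -/
theorem exists_chart_of_leftInverse [Nonempty V] {U : Set V} (hU : IsOpen U)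
    {F : V → EuclideanSpace ℝ (Fin 4)}
    (hF : ContMDiffOn (𝓡 4) 𝓘(ℝ, EuclideanSpace ℝ (Fin 4)) ∞ F U) (hinj : InjOn F U)
    (hR : ∀ p ∈ U, ∃ R : EuclideanSpace ℝ (Fin 4) → V,
      ContMDiffAt 𝓘(ℝ, EuclideanSpace ℝ (Fin 4)) (𝓡 4) ∞ R (F p) ∧ ∀ᶠ q in 𝓝 p, R (F q) = q) :
    ∃ e : OpenPartialHomeomorph V (EuclideanSpace ℝ (Fin 4)),
      e ∈ IsManifold.maximalAtlas (𝓡 4) ∞ V ∧ e.source = U ∧ ∀ p, e p = F p := by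
  have hmap : ∀ p ∈ U, map F (𝓝 p) = 𝓝 (F p) := fun p hp => by
    obtain ⟨R, h1, h2⟩ := hR p hp
    exact map_nhds_eq_of_leftInverse (hF.contMDiffAt (hU.mem_nhds hp)) h1 h2
  let e := OpenPartialHomeomorph.ofContinuousOpenRestrict (hinj.toPartialEquiv F U)
    hF.continuousOn (by
      refine isOpenMap_iff_nhds_le.2 fun p => ?_
      change 𝓝 (F p.1) ≤ map (F ∘ Subtype.val) (𝓝 p)
      rw [← map_map, map_nhds_subtype_coe_eq_nhds p.2 (hU.mem_nhds p.2), hmap p.1 p.2]) hU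
  refine ⟨e, e.mem_maximalAtlas_of_contMDiffOn hF ?_, rfl, fun p => rfl⟩
  intro y hy
  -- Near y the inverse of `e` agrees with the smooth local left inverse R, because F (e.symm z) =
  -- z.
  obtain ⟨R, hR1, hR2⟩ := hR (e.symm y) (e.map_target hy)
  have hy' : F (e.symm y) = y := e.right_inv hy
  rw [hy'] at hR1
  refine (hR1.congr_of_eventuallyEq ?_).contMDiffWithinAt
  filter_upwards [(e.continuousAt_symm hy).eventually hR2, e.open_target.mem_nhds hy] with z hz hzt
  have hz' : F (e.symm z) = z := e.right_inv hzt
  rw [hz'] at hz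
  exact hz.symm

end Charts

namespace LorentzMetric

variable {V : Type*} [TopologicalSpace V] [ChartedSpace (EuclideanSpace ℝ (Fin 4)) V]
  [IsManifold (𝓡 4) ∞ V] {g : LorentzMetric V} {u ub : V → ℝ}

namespace IsDoubleNullFoliation

/-- Coordinates `(u, u̲, ω¹, ω²)` carried along the incoming generators from the initial patch,
with the azimuth shifted by a function of the other three coordinates. -/
theorem exists_chart [T2Space V] [Nonempty V] (hfol : g.IsDoubleNullFoliation u ub)
    {A : Set (ℝ × ℝ × ℝ)} {ι : ℝ × ℝ × ℝ → V} (hι : g.IsInitialPatch u ub A ι)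
    {s₀ : ℝ} {J : Set ℝ} (hJ : IsOpen J) {f : ℝ → ℝ → ℝ → ℝ}
    (hf : ContDiffOn ℝ ∞ (fun y : ℝ × ℝ × ℝ => f y.1 y.2.1 y.2.2)
      {y | s₀ < y.2.1 - y.1 ∧ y.2.2 ∈ J}) :
    ∃ e : OpenPartialHomeomorph V (EuclideanSpace ℝ (Fin 4)),
      e ∈ IsManifold.maximalAtlas (𝓡 4) ∞ V ∧
      e.source = {p | s₀ < ub p - u p ∧
        ∃ w ∈ A, w.2.1 ∈ J ∧ g.OnIncomingGenerator u ub (ι w) p} ∧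
      ∀ p ∈ e.source, ∀ w ∈ A, g.OnIncomingGenerator u ub (ι w) p →
        e p 0 = u p ∧ e p 1 = ub p ∧ e p 2 = w.2.1 ∧
        e p 3 = w.2.2 + f (u p) (ub p) w.2.1 := by
  set U : Set V := {p | s₀ < ub p - u p ∧
    ∃ w ∈ A, w.2.1 ∈ J ∧ g.OnIncomingGenerator u ub (ι w) p} with hUdef
  have hex : ∀ p : V, ∃ w : ℝ × ℝ × ℝ, p ∈ U →
      w ∈ A ∧ w.2.1 ∈ J ∧ g.OnIncomingGenerator u ub (ι w) p := by
    intro p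
    -- W p is the base point of the generator through p; off U it is set to 0, a value that is never
    -- used.
    by_cases hp : p ∈ U
    · exact ⟨hp.2.choose, fun _ => hp.2.choose_spec⟩
    · exact ⟨0, fun h => absurd h hp⟩
  choose W hW using hex
  have hWeq : ∀ p ∈ U, ∀ w ∈ A, g.OnIncomingGenerator u ub (ι w) p → W p = w := fun p hp w hw h =>
    hfol.eq_of_onIncomingGenerator hι (hW p hp).1 hw (hW p hp).2.2 h
  have hW1 : ∀ p ∈ U, (W p).1 = ub p := fun p hp =>
    (hι.ub_eq _ (hW p hp).1).symm.trans (hfol.ub_eq_of_joined (hW p hp).2.2).symm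
  have hloc : ∀ p ∈ U, U ∈ 𝓝 p ∧ ContMDiffAt (𝓡 4) 𝓘(ℝ, ℝ × ℝ × ℝ) ∞ W p ∧
      ∃ R : (ℝ × ℝ × ℝ) × ℝ → V,
        ContMDiffAt 𝓘(ℝ, (ℝ × ℝ × ℝ) × ℝ) (𝓡 4) ∞ R (W p, u p) ∧
        ∀ᶠ q in 𝓝 p, R (W q, u q) = q := by
    intro p hp
    obtain ⟨O, hO, hpO, W', hW', hW'A, hW'g, R, hR, hRW⟩ :=
      hfol.exists_coordinates_near hι (hW p hp).1 (hW p hp).2.2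
    have hpW : W' p = W p := (hWeq p hp _ (hW'A p hpO) (hW'g p hpO)).symm
    have hc : ContMDiffAt (𝓡 4) 𝓘(ℝ, ℝ × ℝ × ℝ) ∞ W' p := hW'.contMDiffAt (hO.mem_nhds hpO)
    have hUp : U ∈ 𝓝 p := by
      have h1 : ∀ᶠ q in 𝓝 p, s₀ < ub q - u q :=
        (hfol.contMDiff_ub.continuous.sub hfol.contMDiff_u.continuous).continuousAt.eventually
          (lt_mem_nhds hp.1)
      have h2 : ∀ᶠ q in 𝓝 p, (W' q).2.1 ∈ J := by
        refine (continuous_snd.fst.continuousAt.comp hc.continuousAt).eventually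
          (hJ.mem_nhds ?_)
        simp only [Function.comp]
        rw [hpW]
        exact (hW p hp).2.1
      filter_upwards [h1, h2, hO.mem_nhds hpO] with q hq1 hq2 hqO
      exact ⟨hq1, W' q, hW'A q hqO, hq2, hW'g q hqO⟩
    have hev : ∀ᶠ q in 𝓝 p, W q = W' q := by
      filter_upwards [hUp, hO.mem_nhds hpO] with q hq hqO
      exact hWeq q hq _ (hW'A q hqO) (hW'g q hqO)
    refine ⟨hUp, hc.congr_of_eventuallyEq hev, R, hpW ▸ hR, ?_⟩
    filter_upwards [hev, hO.mem_nhds hpO] with q hq hqO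
    rw [hq]
    exact hRW q hqO
  have hU : IsOpen U := isOpen_iff_mem_nhds.2 fun p hp => (hloc p hp).1
  have hDo : IsOpen {y : ℝ × ℝ × ℝ | s₀ < y.2.1 - y.1 ∧ y.2.2 ∈ J} :=
    (isOpen_lt continuous_const (continuous_snd.fst.sub continuous_fst)).inter
      (hJ.preimage continuous_snd.snd)
  set F : V → EuclideanSpace ℝ (Fin 4) := fun p =>
    !₂[u p, ub p, (W p).2.1, (W p).2.2 + f (u p) (ub p) (W p).2.1] with hFdef
  have hF : ContMDiffOn (𝓡 4) 𝓘(ℝ, EuclideanSpace ℝ (Fin 4)) ∞ F U := by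
    intro p hp
    have hu : ContMDiffAt (𝓡 4) 𝓘(ℝ) ∞ u p := hfol.contMDiff_u p
    have hub : ContMDiffAt (𝓡 4) 𝓘(ℝ) ∞ ub p := hfol.contMDiff_ub p
    have h2 : ContMDiffAt (𝓡 4) 𝓘(ℝ) ∞ (fun q => (W q).2.1) p :=
      ContMDiffAt.comp (g := fun w : ℝ × ℝ × ℝ => w.2.1) p
        (by fun_prop : ContDiff ℝ ∞ (fun w : ℝ × ℝ × ℝ => w.2.1)).contMDiff.contMDiffAt
        (hloc p hp).2.1
    have h3 : ContMDiffAt (𝓡 4) 𝓘(ℝ) ∞ (fun q => (W q).2.2) p :=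
      ContMDiffAt.comp (g := fun w : ℝ × ℝ × ℝ => w.2.2) p
        (by fun_prop : ContDiff ℝ ∞ (fun w : ℝ × ℝ × ℝ => w.2.2)).contMDiff.contMDiffAt
        (hloc p hp).2.1
    have h4 : ContMDiffAt (𝓡 4) 𝓘(ℝ) ∞ (fun q => f (u q) (ub q) (W q).2.1) p :=
      ContMDiffAt.comp (g := fun y : ℝ × ℝ × ℝ => f y.1 y.2.1 y.2.2) p
        (contMDiffAt_iff_contDiffAt.2 (hf.contDiffAt (hDo.mem_nhds ⟨hp.1, (hW p hp).2.1⟩)))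
        (hu.prodMk_space (hub.prodMk_space h2))
    have h5 : ContMDiffAt (𝓡 4) 𝓘(ℝ, Fin 4 → ℝ) ∞
        (fun q => ![u q, ub q, (W q).2.1, (W q).2.2 + f (u q) (ub q) (W q).2.1]) p := by
      rw [contMDiffAt_pi_space]
      intro i
      fin_cases i
      · exact hu
      · exact hub
      · exact h2
      · exact h3.add h4
    exact (ContMDiffAt.comp (g := (EuclideanSpace.equiv (Fin 4) ℝ).symm) p
      (EuclideanSpace.equiv (Fin 4) ℝ).symm.contDiff.contMDiff.contMDiffAt h5).contMDiffWithinAt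
  have hF0 : ∀ p, F p 0 = u p := fun p => rfl
  have hF1 : ∀ p, F p 1 = ub p := fun p => rfl
  have hF2 : ∀ p, F p 2 = (W p).2.1 := fun p => rfl
  have hF3 : ∀ p, F p 3 = (W p).2.2 + f (u p) (ub p) (W p).2.1 := fun p => rfl
  -- T undoes the azimuth shift, which is possible because f depends only on the first three
  -- coordinates. Composed with the local R it gives the smooth left inverse of F.
  set T : EuclideanSpace ℝ (Fin 4) → (ℝ × ℝ × ℝ) × ℝ := fun y =>
    ((y 1, y 2, y 3 - f (y 0) (y 1) (y 2)), y 0) with hT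
  have hTF : ∀ p ∈ U, T (F p) = (W p, u p) := by
    intro p hp
    simp only [hT, hF0, hF1, hF2, hF3, add_sub_cancel_right]
    rw [← hW1 p hp]
  have hinj : InjOn F U := by
    intro p hp q hq hpq
    have h1 : (W p, u p) = (W q, u q) := by rw [← hTF p hp, ← hTF q hq, hpq]
    obtain ⟨h2, h3⟩ := Prod.mk.inj h1
    have h4 : Joined (g.incoming u ub) (u (ι (W p))) (u p) (ι (W p)) p := (hW p hp).2.2
    have h5 : Joined (g.incoming u ub) (u (ι (W q))) (u q) (ι (W q)) q := (hW q hq).2.2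
    rw [← h2, ← h3] at h5
    -- The two points start from the same patch point and are reached at the same parameter u, so
    -- they coincide.
    exact h4.unique hfol.contMDiff_incoming h5
  obtain ⟨e, he, hes, heF⟩ := exists_chart_of_leftInverse hU hF hinj (fun p hp => by
    obtain ⟨-, -, R, hR, hRW⟩ := hloc p hp
    refine ⟨R ∘ T, ContMDiffAt.comp (g := R) (F p) (by rwa [hTF p hp]) ?_, ?_⟩
    · refine contMDiffAt_iff_contDiffAt.2 ?_
      have hcoord : ContDiff ℝ ∞ (fun y : EuclideanSpace ℝ (Fin 4) => (y 0, y 1, y 2)) := by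
        fun_prop
      have h1 : ContDiffAt ℝ ∞ (fun y : EuclideanSpace ℝ (Fin 4) => f (y 0) (y 1) (y 2)) (F p) :=
        ContDiffAt.comp (g := fun y : ℝ × ℝ × ℝ => f y.1 y.2.1 y.2.2) (F p)
          (hf.contDiffAt (hDo.mem_nhds ⟨hp.1, (hW p hp).2.1⟩)) hcoord.contDiffAt
      have hi : ∀ i, ContDiffAt ℝ ∞ (fun y : EuclideanSpace ℝ (Fin 4) => y i) (F p) := by
        fun_prop
      exact ((hi 1).prodMk ((hi 2).prodMk ((hi 3).sub h1))).prodMk (hi 0)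
    · filter_upwards [hRW, hU.mem_nhds hp] with q hq hqU
      rw [Function.comp_apply, hTF q hqU]
      exact hq)
  refine ⟨e, he, hes, fun p hp w hw h => ?_⟩
  rw [hes] at hp
  rw [heF, hF0, hF1, hF2, hF3, hWeq p hp w hw h]
  exact ⟨rfl, rfl, rfl, rfl⟩

end IsDoubleNullFoliation
end LorentzMetric

/-! ### Coordinate differentials and coordinate vector fields -/

section CoordinateFrame

variable {V : Type*} [TopologicalSpace V] [ChartedSpace (EuclideanSpace ℝ (Fin 4)) V]

/-- The derivative of a function along a vector field, computed on an integral curve. -/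
theorem diff_eq_of_isMIntegralCurveOn {v : (p : V) → TangentSpace (𝓡 4) p} {f : V → ℝ} {γ : ℝ → V}
    {s : Set ℝ} {t c : ℝ} (hs : s ∈ 𝓝 t) (hγ : IsMIntegralCurveOn γ v s)
    (hf : MDifferentiableAt (𝓡 4) 𝓘(ℝ) f (γ t)) (h : HasDerivAt (fun τ => f (γ τ)) c t) :
    diff f (γ t) (v (γ t)) = c := by
  have h1 := hf.hasMFDerivAt.comp t ((hγ t (mem_of_mem_nhds hs)).hasMFDerivAt hs)
  have h2 := h.hasFDerivAt.unique (hasMFDerivAt_iff_hasFDerivAt.1 h1)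
  have h3 : mfderiv (𝓡 4) 𝓘(ℝ) f (γ t) ((1 : ℝ) • v (γ t)) = (1 : ℝ) • c :=
    (congrArg (fun L : ℝ →L[ℝ] ℝ => L 1) h2).symm
  rwa [one_smul, one_smul] at h3

variable {e : OpenPartialHomeomorph V (EuclideanSpace ℝ (Fin 4))}

theorem contMDiffAt_of_mem_maximalAtlas (he : e ∈ IsManifold.maximalAtlas (𝓡 4) ∞ V) {p : V}
    (hp : p ∈ e.source) :
    ContMDiffAt (𝓡 4) 𝓘(ℝ, EuclideanSpace ℝ (Fin 4)) ∞ e p :=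
  (contMDiffOn_of_mem_maximalAtlas he).contMDiffAt (e.open_source.mem_nhds hp)

theorem contMDiffAt_coord (he : e ∈ IsManifold.maximalAtlas (𝓡 4) ∞ V) {p : V}
    (hp : p ∈ e.source) (i : Fin 4) : ContMDiffAt (𝓡 4) 𝓘(ℝ) ∞ (fun q => e q i) p :=
  ContMDiffAt.comp (g := fun y : EuclideanSpace ℝ (Fin 4) => y i) p
    (by fun_prop : ContDiff ℝ ∞ (fun y : EuclideanSpace ℝ (Fin 4) => y i)).contMDiff.contMDiffAt
    (contMDiffAt_of_mem_maximalAtlas he hp)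

theorem diff_coord (he : e ∈ IsManifold.maximalAtlas (𝓡 4) ∞ V) {p : V} (hp : p ∈ e.source)
    (i : Fin 4) (z : TangentSpace (𝓡 4) p) :
    diff (fun q => e q i) p z =
      WithLp.ofLp (p := 2) (V := Fin 4 → ℝ)
        (mfderiv (𝓡 4) 𝓘(ℝ, EuclideanSpace ℝ (Fin 4)) e p z) i := by
  have h1 := ((contMDiffAt_of_mem_maximalAtlas he hp).mdifferentiableAt (by simp)).hasMFDerivAt
  have h2 : HasMFDerivAt 𝓘(ℝ, EuclideanSpace ℝ (Fin 4)) 𝓘(ℝ)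
      (EuclideanSpace.proj i : EuclideanSpace ℝ (Fin 4) →L[ℝ] ℝ) (e p)
      (EuclideanSpace.proj i : EuclideanSpace ℝ (Fin 4) →L[ℝ] ℝ) :=
    (ContinuousLinearMap.hasFDerivAt _).hasMFDerivAt
  exact DFunLike.congr_fun (h2.comp p h1).mfderiv z

variable [IsManifold (𝓡 4) ∞ V]

theorem isInvertible_mfderiv_chart (he : e ∈ IsManifold.maximalAtlas (𝓡 4) ∞ V) {p : V}
    (hp : p ∈ e.source) :
    (mfderiv (𝓡 4) 𝓘(ℝ, EuclideanSpace ℝ (Fin 4)) e p).IsInvertible := by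
  have : IsManifold (𝓡 4) 1 V := IsManifold.of_le (n := ∞) (by simp)
  have hd : e.MDifferentiable (𝓡 4) 𝓘(ℝ, EuclideanSpace ℝ (Fin 4)) :=
    ⟨(contMDiffOn_of_mem_maximalAtlas he).mdifferentiableOn (by simp),
      (contMDiffOn_symm_of_mem_maximalAtlas he).mdifferentiableOn (by simp)⟩
  exact ⟨hd.mfderiv hp, rfl⟩

theorem eq_zero_of_diff_coord (he : e ∈ IsManifold.maximalAtlas (𝓡 4) ∞ V) {p : V}
    (hp : p ∈ e.source) {z : TangentSpace (𝓡 4) p} (hz : ∀ i, diff (fun q => e q i) p z = 0) :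
    z = 0 := by
  obtain ⟨L, hL⟩ := isInvertible_mfderiv_chart he hp
  have h : L z = 0 := by
    refine PiLp.ext fun i => ?_
    rw [← ContinuousLinearEquiv.coe_coe, hL]
    exact (diff_coord he hp i z).symm.trans (hz i)
  exact (map_eq_zero_iff L L.injective).1 h

/-- The coordinate vector fields of a chart. -/
def coordVector (e : OpenPartialHomeomorph V (EuclideanSpace ℝ (Fin 4))) (j : Fin 4) (p : V) :
    TangentSpace (𝓡 4) p :=
  VectorField.mpullback (𝓡 4) 𝓘(ℝ, EuclideanSpace ℝ (Fin 4)) e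
    (fun _ => (EuclideanSpace.single j 1 : EuclideanSpace ℝ (Fin 4))) p

theorem diff_coord_coordVector (he : e ∈ IsManifold.maximalAtlas (𝓡 4) ∞ V) {p : V}
    (hp : p ∈ e.source) (i j : Fin 4) :
    diff (fun q => e q i) p (coordVector e j p) = if i = j then 1 else 0 := by
  have h : mfderiv (𝓡 4) 𝓘(ℝ, EuclideanSpace ℝ (Fin 4)) e p (coordVector e j p) =
      (EuclideanSpace.single j 1 : EuclideanSpace ℝ (Fin 4)) :=
    (isInvertible_mfderiv_chart he hp).self_apply_inverse _
  rw [diff_coord he hp, h]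
  simp

theorem smoothFieldAt_coordVector (he : e ∈ IsManifold.maximalAtlas (𝓡 4) ∞ V) {p : V}
    (hp : p ∈ e.source) (j : Fin 4) : SmoothFieldAt (coordVector e j) p := by
  have : IsManifold (𝓡 4) 1 V := IsManifold.of_le (n := ∞) (by simp)
  refine ContMDiffAt.mpullback_vectorField_preimage ?_ (contMDiffAt_of_mem_maximalAtlas he hp)
    (isInvertible_mfderiv_chart he hp) (by simp)
  exact contMDiffAt_vectorSpace_iff_contDiffAt.2 contDiffAt_const

end CoordinateFrame

namespace LorentzMetric

variable {V : Type*} [TopologicalSpace V] [ChartedSpace (EuclideanSpace ℝ (Fin 4)) V]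
  [IsManifold (𝓡 4) ∞ V] {g : LorentzMetric V} {u ub : V → ℝ}

namespace IsDoubleNullFoliation

/-- The generator through a point stays, near that point, on the same generator of the initial
patch, and `u` is its parameter. -/
theorem exists_generator_near [T2Space V] (hfol : g.IsDoubleNullFoliation u ub) {q p : V}
    (h : g.OnIncomingGenerator u ub q p) :
    ∃ γ : ℝ → V, ∃ s ∈ 𝓝 (0 : ℝ), IsMIntegralCurveOn γ (g.incoming u ub) s ∧ γ 0 = p ∧
      ∀ t ∈ s, g.OnIncomingGenerator u ub q (γ t) ∧ u (γ t) = u p + t ∧ ub (γ t) = ub p := by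
  obtain ⟨ε, hε, O, hO, hpO, Fl, -, hFl⟩ :=
    exists_smooth_local_flow_manifold hfol.contMDiff_incoming p
  obtain ⟨h0, hγ⟩ := hFl p hpO
  have hε0 : (0 : ℝ) ∈ Ioo (-ε) ε := ⟨neg_lt_zero.2 hε, hε⟩
  refine ⟨fun t => Fl (p, t), Ioo (-ε) ε, Ioo_mem_nhds hε0.1 hε0.2, hγ, h0, fun t ht => ?_⟩
  have hj : Joined (g.incoming u ub) 0 t p (Fl (p, t)) := by
    have := joined_of_mem hγ (OrdConnected.uIcc_subset ordConnected_Ioo hε0 ht)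
    rwa [h0] at this
  have hu := hfol.u_sub_of_joined hj
  refine ⟨?_, by simp only; linarith, hfol.ub_eq_of_joined hj⟩
  have hj' := hj.shift (u p)
  rw [zero_add] at hj'
  exact hfol.onIncomingGenerator_of_joined (Joined.trans hfol.contMDiff_incoming h hj')

end IsDoubleNullFoliation
end LorentzMetric

end KerrFoliation

end

/-! ### Kerr coordinates and the metric in them -/

theorem mainTheorem6 {V : Type*} [TopologicalSpace V] [T2Space V] [Nonempty V]
    [ChartedSpace (EuclideanSpace ℝ (Fin 4)) V] [IsManifold (𝓡 4) ∞ V]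
    (g : KerrFoliation.LorentzMetric V) (u ub : V → ℝ)
    (hfol : g.IsDoubleNullFoliation u ub)
    (A : Set (ℝ × ℝ × ℝ)) (ι : ℝ × ℝ × ℝ → V) (hι : g.IsInitialPatch u ub A ι)
    (M a s₀ : ℝ) (hM : 0 < M) (ha : |a| ≤ M)
    (Φ : KerrFoliation.PretoriusIsraelChart M a s₀) :
    ∃ (f : ℝ → ℝ → ℝ → ℝ) (e : OpenPartialHomeomorph V (EuclideanSpace ℝ (Fin 4)))
      (γ : Fin 2 → Fin 2 → V → ℝ) (X : Fin 2 → V → ℝ),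
      -- the coordinate change `ω² = x² + f(u, u̲, ω¹)`, with `∂f/∂u = ω_B`
      ContDiffOn ℝ ∞ (fun y : ℝ × ℝ × ℝ => f y.1 y.2.1 y.2.2)
        {y | s₀ < y.2.1 - y.1 ∧ y.2.2 ∈ Ioo 0 Real.pi} ∧
      (∀ l m θ : ℝ, s₀ < m - l → θ ∈ Ioo 0 Real.pi →
        HasDerivAt (fun l' => f l' m θ) (Φ.omegaB l m θ) l) ∧
      -- `e = (u, u̲, ω¹, ω²)` are smooth coordinates on the part of `r_* = u̲ - u > s₀`
      -- swept out by the incoming generators through the initial patch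
      e ∈ IsManifold.maximalAtlas (𝓡 4) ∞ V ∧
      e.source = {p | s₀ < ub p - u p ∧
        ∃ w ∈ A, w.2.1 ∈ Ioo 0 Real.pi ∧ g.OnIncomingGenerator u ub (ι w) p} ∧
      (∀ p ∈ e.source, ∀ w ∈ A, g.OnIncomingGenerator u ub (ι w) p →
        e p 0 = u p ∧ e p 1 = ub p ∧ e p 2 = w.2.1 ∧
        e p 3 = w.2.2 + f (u p) (ub p) w.2.1) ∧
      -- `γ_ab` and `X^a` are smooth, and `γ` is a Riemannian metric on the surfaces `S(u, u̲)`
      (∀ i, ContMDiffOn (𝓡 4) 𝓘(ℝ) ∞ (X i) e.source) ∧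
      (∀ i j, ContMDiffOn (𝓡 4) 𝓘(ℝ) ∞ (γ i j) e.source) ∧
      ∀ p ∈ e.source,
        (Matrix.of fun i j => γ i j p).PosDef ∧
        -- `N̲ = ∂/∂u + X_Kerr` and `N = ∂/∂u̲ + X`
        (KerrFoliation.diff u p (g.incoming u ub p) = 1 ∧
          KerrFoliation.diff ub p (g.incoming u ub p) = 0 ∧
          KerrFoliation.diff (fun q => e q 2) p (g.incoming u ub p) =
            Φ.shift (u p) (ub p) (e p 2) 0 ∧
          KerrFoliation.diff (fun q => e q 3) p (g.incoming u ub p) =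
            Φ.shift (u p) (ub p) (e p 2) 1) ∧
        (KerrFoliation.diff u p (g.outgoing u ub p) = 0 ∧
          KerrFoliation.diff ub p (g.outgoing u ub p) = 1 ∧
          KerrFoliation.diff (fun q => e q 2) p (g.outgoing u ub p) = X 0 p ∧
          KerrFoliation.diff (fun q => e q 3) p (g.outgoing u ub p) = X 1 p) ∧
        -- the lapse
        0 < g.lapse u ub p ∧
        g.val p (g.nullGen u p) (g.nullGen ub p) = -(2 * g.lapse u ub p ^ 2)⁻¹ ∧
        -- the metric
        ∀ v w : TangentSpace (𝓡 4) p,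
          let dω : Fin 2 → TangentSpace (𝓡 4) p → ℝ :=
            ![KerrFoliation.diff (fun q => e q 2) p, KerrFoliation.diff (fun q => e q 3) p]
          let η : Fin 2 → TangentSpace (𝓡 4) p → ℝ := fun i z =>
            dω i z - (Φ.shift (u p) (ub p) (e p 2) i * KerrFoliation.diff u p z +
              X i p * KerrFoliation.diff ub p z)
          g.val p v w =
            -2 * g.lapse u ub p ^ 2 *
                (KerrFoliation.diff u p v * KerrFoliation.diff ub p w +
                  KerrFoliation.diff ub p v * KerrFoliation.diff u p w) +
              ∑ i, ∑ j, γ i j p * η i v * η j w := by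
  obtain ⟨e, he, hes, hcoord⟩ := hfol.exists_chart hι isOpen_Ioo (Φ.contDiffOn_azimuthShift hM.le)
  -- The angular indices 0 and 1 are the chart coordinates 2 and 3.
  have hidx : ∀ k : Fin 2 → Fin 4 → Prop, k 0 2 → k 1 3 → ∀ i, k i (![2, 3] i) := by
    intro k h0 h1 i
    fin_cases i
    · exact h0
    · exact h1
  have hsrc : ∀ p ∈ e.source, s₀ < ub p - u p ∧
      ∃ w ∈ A, w.2.1 ∈ Ioo 0 Real.pi ∧ g.OnIncomingGenerator u ub (ι w) p := fun p hp => by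
    rw [hes] at hp
    exact hp
  have hd0 : ∀ p ∈ e.source, KerrFoliation.diff (fun q => e q 0) p = KerrFoliation.diff u p :=
    fun p hp => Filter.EventuallyEq.mfderiv_eq (Filter.mem_of_superset
      (e.open_source.mem_nhds hp) fun q hq => by
        obtain ⟨w, hw, -, hwq⟩ := (hsrc q hq).2
        exact (hcoord q hq w hw hwq).1)
  have hd1 : ∀ p ∈ e.source, KerrFoliation.diff (fun q => e q 1) p = KerrFoliation.diff ub p :=
    fun p hp => Filter.EventuallyEq.mfderiv_eq (Filter.mem_of_superset
      (e.open_source.mem_nhds hp) fun q hq => by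
        obtain ⟨w, hw, -, hwq⟩ := (hsrc q hq).2
        exact (hcoord q hq w hw hwq).2.1)
  -- Along the generator through p the base point w is fixed, so ω¹ is constant while ω² varies only
  -- through f, at the rate ∂f/∂u = ω_B.
  have hin : ∀ p ∈ e.source, ∀ i, KerrFoliation.diff (fun q => e q (![2, 3] i)) p
      (g.incoming u ub p) = Φ.shift (u p) (ub p) (e p 2) i := by
    intro p hp
    obtain ⟨hs₀, w, hw, hwI, hwp⟩ := hsrc p hp
    obtain ⟨-, -, he2, -⟩ := hcoord p hp w hw hwp
    obtain ⟨δ, s, hs, hδ, hδ0, hδs⟩ := hfol.exists_generator_near hwp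
    have hev : ∀ᶠ t in nhds (0 : ℝ), e (δ t) 2 = w.2.1 ∧
        e (δ t) 3 = w.2.2 + Φ.azimuthShift (u p + t) (ub p) w.2.1 := by
      have hc : ContinuousAt δ 0 := (hδ 0 (mem_of_mem_nhds hs)).continuousWithinAt.continuousAt hs
      filter_upwards [hs, hc.eventually (e.open_source.mem_nhds (by rwa [hδ0]))] with t ht htU
      obtain ⟨h1, h2, h3⟩ := hδs t ht
      obtain ⟨-, -, h4, h5⟩ := hcoord _ htU w hw h1
      rw [h2, h3] at h5
      exact ⟨h4, h5⟩
    refine hidx (fun i j => KerrFoliation.diff (fun q => e q j) p (g.incoming u ub p) =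
      Φ.shift (u p) (ub p) (e p 2) i) ?_ ?_
    · have h := KerrFoliation.diff_eq_of_isMIntegralCurveOn (f := fun q => e q 2) (c := 0) hs hδ
        ((KerrFoliation.contMDiffAt_coord he (by rwa [hδ0]) 2).mdifferentiableAt (by simp))
        ((hasDerivAt_const (0 : ℝ) w.2.1).congr_of_eventuallyEq (hev.mono fun t ht => ht.1))
      rw [hδ0] at h
      exact h
    · have h1 : HasDerivAt (fun t => Φ.azimuthShift (u p + t) (ub p) w.2.1)
          (Φ.omegaB (u p) (ub p) w.2.1) 0 := by
        have h2 := Φ.hasDerivAt_azimuthShift hM.le hs₀ hwI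
        rw [← add_zero (u p)] at h2
        have h3 := h2.comp_const_add (u p) 0
        rwa [add_zero] at h3
      have h := KerrFoliation.diff_eq_of_isMIntegralCurveOn (f := fun q => e q 3) hs hδ
        ((KerrFoliation.contMDiffAt_coord he (by rwa [hδ0]) 3).mdifferentiableAt (by simp))
        ((h1.const_add w.2.2).congr_of_eventuallyEq (hev.mono fun t ht => ht.2))
      rw [hδ0] at h
      simp only [he2]
      exact h
  refine ⟨Φ.azimuthShift, e,
    fun i j p => g.val p (KerrFoliation.coordVector e (![2, 3] i) p)
      (KerrFoliation.coordVector e (![2, 3] j) p),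
    fun i p => KerrFoliation.diff (fun q => e q (![2, 3] i)) p (g.outgoing u ub p),
    Φ.contDiffOn_azimuthShift hM.le, fun l m θ h hθ => Φ.hasDerivAt_azimuthShift hM.le h hθ, he,
    hes, hcoord, fun i p hp => ?_, fun i j p hp => ?_, fun p hp => ?_⟩
  · exact (KerrFoliation.SmoothFieldAt.diff (KerrFoliation.contMDiffAt_coord he hp _)
      (hfol.smoothFieldAt_outgoing p)).contMDiffWithinAt
  · exact (g.contMDiffAt_val (KerrFoliation.smoothFieldAt_coordVector he hp _)
      (KerrFoliation.smoothFieldAt_coordVector he hp _)).contMDiffWithinAt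
  obtain ⟨hpos, hmetric⟩ := hfol.metric_decomposition
    (fun i => KerrFoliation.diff (fun q => e q (![2, 3] i)) p)
    (fun j => KerrFoliation.coordVector e (![2, 3] j) p)
    (fun i => by
      rw [← hd0 p hp, KerrFoliation.diff_coord_coordVector he hp]
      fin_cases i <;> simp)
    (fun i => by
      rw [← hd1 p hp, KerrFoliation.diff_coord_coordVector he hp]
      fin_cases i <;> simp)
    (fun i j => by
      rw [KerrFoliation.diff_coord_coordVector he hp]
      fin_cases i <;> fin_cases j <;> simp)
    (fun z h0 h1 h2 => by
      refine KerrFoliation.eq_zero_of_diff_coord he hp fun i => ?_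
      fin_cases i
      · exact (DFunLike.congr_fun (hd0 p hp) z).trans h0
      · exact (DFunLike.congr_fun (hd1 p hp) z).trans h1
      · exact h2 0
      · exact h2 1)
  refine ⟨hpos, ⟨hfol.diff_u_incoming p, hfol.diff_ub_incoming p, hin p hp 0, hin p hp 1⟩,
    ⟨hfol.diff_u_outgoing p, hfol.diff_ub_outgoing p, rfl, rfl⟩, hfol.lapse_pos p,
    hfol.val_eq_lapse p, fun v w => ?_⟩
  refine (hmetric v w).trans ?_
  simp only [hin p hp, Fin.sum_univ_two]
  rfl
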